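/- \textbf{Setting.} Let $\phi:[0,\infty)\times[0,\infty)\to[0,\infty)$ be a flow: $\phi$ is $\mathcal C^1$, $\phi(x,0)=x$, $\phi(x,t+s)=\phi(\phi(x,s),t)$, every $\phi(\cdot,t)$ is a homeomorphism onto its image, and every $\phi_x=\phi(x,\cdot)$ is an increasing $\mathcal C^1$-diffeomorphism of $[0,\infty)$ onto $[x,\infty)$. Let $f:[0,\infty)\to[0,\infty)$ be an increasing $\mathcal C^1$-diffeomorphism such that, for some $0<\kappa<1$, $0<f(x)\le\kappa x$ for all $x>0$. Put $g_x(y)=[(f\circ\phi_x)^{-1}]'(y)$ for $y\ge f(x)$ and suppose that there are continuous functions $\mathbf m,\mathbf M:[0,\infty)\to(0,\infty)$ with $\mathbf m\le\mathbf M$ and $\mathbf m(y)\le g_x(y)\le\mathbf M(y)$ for all $x\ge0$ and all $y>0$ with $y\ge f(x)$. For $b>0$ and $\mathfrak c=(r,L,\mathbf a)$ with $r,L,\mathbf a>0$ and \[ r\ge f^{-1}\left(\left[\frac{-\ln(1-\kappa^{b+1})}{1-\kappa^{b+1}}\right]^{1/(b+1)}\right), \] let $\mathcal F(\mathfrak c,b)$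 be the set of continuous functions $\lambda:[0,\infty)\to[0,\infty)$ such that \[ \frac{f(x)^b}{\mathbf m(f(x))}\le\frac{\lambda(x)}{\mathbf a}\quad(x\ge r),\qquad \int_0^{f(r)}\mathbf M(u)\,\lambda(f^{-1}(u))\,du\le L. \] For a jump rate $\lambda\in\mathcal F(\mathfrak c,b)$ and $x\ge0$ let $T_1$ be a random time with $\mathbb P_x(T_1>t)=\exp\left(-\int_0^t\lambda(\phi(x,s))\,ds\right)$, and let $\mathcal P_\lambda(x,\cdot)$ be the law of $f(\phi(x,T_1))$. Let $(Z_k)_{k\ge0}$ be the Markov chain with $Z_0=x_0$ and transition kernel $\mathcal P_\lambda$, that is, the chain of post-jump locations of the piecewise deterministic Markov process with flow $\phi$, jump rate $\lambda$ and deterministic jumps $x\mapsto f(x)$, started at $x_0$. Put $\mathbb V(x)=\exp\left(\frac{\mathbf a}{b+1}f(x)^{b+1}\right)$ and, for bounded $s$, $\|s\|_\infty=\sup_{x\ge0}|s(x)|$. \textbf{Statement.} With $\phi,f,\kappa,\mathbf m,\mathbf M,\mathfrak c,b$ as above, there are constants $R>0$ and $\gamma\in(0,1)$ such that the following holds. (i)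 For every $\lambda\in\mathcal F(\mathfrak c,b)$ the kernel $\mathcal P_\lambda$ has exactly one invariant probability measure; it has a density $\nu_\lambda$ with respect to Lebesgue measure on $[0,\infty)$; $\int\mathbb V\nu_\lambda<\infty$; and for all $k\ge0$ and $x\ge0$, $\mathcal P_\lambda^k\mathbb V(x)<\infty$ and \[ \left|\mathcal P_\lambda^k\psi(x)-\int\psi(z)\nu_\lambda(z)\,dz\right|\le R\,\mathbb V(x)\,\gamma^k\qquad\text{for all measurable }\psi\text{ with }|\psi|\le\mathbb V. \] (ii) The functions $G_\lambda(z)=\frac{R}{1-\gamma}\left(\mathbb V(z)+\int\mathbb V(x)\nu_\lambda(x)\,dx\right)$ satisfy $\sup_{\lambda\in\mathcal F(\mathfrak c,b)}G_\lambda(z)<\infty$ for every $z\ge0$. (iii) For every $x_0\ge0$ there is a constant $c$, which depends neither on $\lambda$, nor on $s$, nor on $n$, such that for every $\lambda\in\mathcal F(\mathfrak c,b)$, every bounded measurable $s:[0,\infty)\to\mathbb R$ and every $n\ge1$, \[ \left|\mathbb E\left[\frac1n\sum_{k=1}^n s(Z_k)-\int s(x)\nu_\lambda(x)\,dx\right]\right|\le\|s\|_\infty\frac{R\,\mathbb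 V(x_0)}{n(1-\gamma)} \] and \[ \operatorname{Var}\left(\frac1n\sum_{k=1}^n s(Z_k)\right)\le\frac1n\int s^2(z)\nu_\lambda(z)\,dz+\frac{\|s\|_\infty}{n}\int|s(z)|\,\nu_\lambda(z)\,G_\lambda(z)\,dz+\frac{c\,\|s\|_\infty^2}{n^2}. \] -/

import Mathlib

open MeasureTheory ProbabilityTheory Set
open scoped NNReal ENNReal

namespace PDMP

/-- Lebesgue measure on the half-line `[0, ∞)`. -/
noncomputable def halfLine : Measure ℝ≥0 :=
  ((volume : Measure ℝ).restrict (Ici 0)).map Real.toNNReal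

instance : SFinite halfLine := by
  unfold halfLine
  infer_instance

/-- The flow `φ x t`, started at `x`, after time `t`: it is jointly `C¹` on `[0, ∞) × [0, ∞)`,
each `φ(·, t)` is a homeomorphism onto its image, the semigroup property holds, and each
`φ(x, ·)` is an increasing `C¹`-diffeomorphism of `[0, ∞)` onto `[x, ∞)`. -/
structure IsFlow (φ : ℝ≥0 → ℝ≥0 → ℝ≥0) : Prop where
  contDiff : ContDiffOn ℝ 1
    (fun p : ℝ × ℝ => (φ p.1.toNNReal p.2.toNNReal : ℝ)) (Ici 0 ×ˢ Ici 0)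
  embedding : ∀ t, Topology.IsEmbedding fun x => φ x t
  zero : ∀ x, φ x 0 = x
  semigroup : ∀ x s t, φ x (t + s) = φ (φ x s) t
  strictMono : ∀ x, StrictMono (φ x)
  range_eq : ∀ x, range (φ x) = Ici x
  deriv_pos : ∀ x t : ℝ≥0,
    0 < derivWithin (fun u : ℝ => (φ x u.toNNReal : ℝ)) (Ici 0) t

/-- The increasing bijection `f` of `[0, ∞)` is a `C¹`-diffeomorphism. -/
structure IsC1Diffeo (f : ℝ≥0 ≃o ℝ≥0) : Prop where
  contDiff : ContDiffOn ℝ 1 (fun x : ℝ => (f x.toNNReal : ℝ)) (Ici 0)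
  contDiff_symm : ContDiffOn ℝ 1 (fun x : ℝ => (f.symm x.toNNReal : ℝ)) (Ici 0)

/-- `g_x(y)`, the derivative at `y` of the inverse of `t ↦ f (φ x t)`, for `y ≥ f x`. -/
noncomputable def invDeriv (φ : ℝ≥0 → ℝ≥0 → ℝ≥0) (f : ℝ≥0 ≃o ℝ≥0) (x y : ℝ≥0) : ℝ :=
  derivWithin (fun u : ℝ => ((Function.invFun (fun t : ℝ≥0 => f (φ x t)) u.toNNReal : ℝ≥0) : ℝ))
    (Ici (f x : ℝ)) y

/-- The standing assumptions on the flow `φ` and the jump map `f`, with the contraction factor `κ`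
and the bounds `m ≤ g ≤ M`. -/
structure Assumptions (φ : ℝ≥0 → ℝ≥0 → ℝ≥0) (f : ℝ≥0 ≃o ℝ≥0) (κ : ℝ) (m M : ℝ≥0 → ℝ) :
    Prop where
  isFlow : IsFlow φ
  isC1Diffeo : IsC1Diffeo f
  kappa_pos : 0 < κ
  kappa_lt_one : κ < 1
  map_le : ∀ x, 0 < x → 0 < f x ∧ (f x : ℝ) ≤ κ * x
  continuous_m : Continuous m
  continuous_M : Continuous M
  m_pos : ∀ y, 0 < m y
  m_le_M : ∀ y, m y ≤ M y
  invDeriv_mem : ∀ x y, 0 < y → f x ≤ y → m y ≤ invDeriv φ f x y ∧ invDeriv φ f x y ≤ M y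

/-- Admissible parameters `(r, L, a)` and `b` of a class of jump rates. -/
structure Parameters (f : ℝ≥0 ≃o ℝ≥0) (κ : ℝ) (r : ℝ≥0) (L a b : ℝ) : Prop where
  r_pos : 0 < r
  L_pos : 0 < L
  a_pos : 0 < a
  b_pos : 0 < b
  le_r : f.symm (Real.toNNReal
    ((-Real.log (1 - κ ^ (b + 1)) / (1 - κ ^ (b + 1))) ^ (1 / (b + 1)))) ≤ r

/-- The class `ℱ(𝔠, b)`, `𝔠 = (r, L, a)`, of jump rates. -/
def rateClass (f : ℝ≥0 ≃o ℝ≥0) (m M : ℝ≥0 → ℝ) (r : ℝ≥0) (L a b : ℝ) : Set (ℝ≥0 → ℝ≥0) :=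
  {rate | Continuous rate ∧
    (∀ x, r ≤ x → (f x : ℝ) ^ b / m (f x) ≤ rate x / a) ∧
    ∫ u in (0 : ℝ)..(f r), M u.toNNReal * rate (f.symm u.toNNReal) ≤ L}

/-- The cumulated jump rate `Λ(x, t) = ∫₀ᵗ λ(φ(x, s)) ds`. -/
noncomputable def cumRate (φ : ℝ≥0 → ℝ≥0 → ℝ≥0) (rate : ℝ≥0 → ℝ≥0) (x t : ℝ≥0) : ℝ :=
  ∫ s in (0 : ℝ)..t, (rate (φ x s.toNNReal) : ℝ)

/-- The density at `t` of the first jump time `T₁` from `x`, whose survival function is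
`exp (-Λ(x, t))`. -/
noncomputable def jumpTimeDensity (φ : ℝ≥0 → ℝ≥0 → ℝ≥0) (rate : ℝ≥0 → ℝ≥0) (x t : ℝ≥0) : ℝ≥0 :=
  rate (φ x t) * Real.toNNReal (Real.exp (-cumRate φ rate x t))

/-- The law of the first jump time `T₁` of the process started at `x`. -/
noncomputable def jumpTimeKernel (φ : ℝ≥0 → ℝ≥0 → ℝ≥0) (rate : ℝ≥0 → ℝ≥0) : Kernel ℝ≥0 ℝ≥0 :=
  Kernel.withDensity (Kernel.const ℝ≥0 halfLine) fun x t => (jumpTimeDensity φ rate x t : ℝ≥0∞)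

instance (φ : ℝ≥0 → ℝ≥0 → ℝ≥0) (rate : ℝ≥0 → ℝ≥0) : IsSFiniteKernel (jumpTimeKernel φ rate) := by
  unfold jumpTimeKernel
  infer_instance

/-- The transition kernel `𝒫_λ(x, dy)` of the post-jump chain: the law of `Z₁ = f (φ x T₁)`. -/
noncomputable def jumpKernel (φ : ℝ≥0 → ℝ≥0 → ℝ≥0) (f : ℝ≥0 ≃o ℝ≥0) (rate : ℝ≥0 → ℝ≥0) :
    Kernel ℝ≥0 ℝ≥0 :=
  (Kernel.id ×ₖ jumpTimeKernel φ rate).map fun p => f (φ p.1 p.2)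

/-- For a continuous flow and a continuous rate, `jumpKernel` is the image under `t ↦ f (φ x t)`
of the measure with density `jumpTimeDensity`. -/
theorem jumpKernel_apply {φ : ℝ≥0 → ℝ≥0 → ℝ≥0} (f : ℝ≥0 ≃o ℝ≥0) {rate : ℝ≥0 → ℝ≥0}
    (hφ : Continuous (Function.uncurry φ)) (hrate : Continuous rate) (x : ℝ≥0) :
    jumpKernel φ f rate x =
      (halfLine.withDensity fun t => (jumpTimeDensity φ rate x t : ℝ≥0∞)).map
        fun t => f (φ x t) := by
  have hcum : Continuous fun p : ℝ≥0 × ℝ≥0 => cumRate φ rate p.1 p.2 := by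
    unfold cumRate
    refine intervalIntegral.continuous_parametric_intervalIntegral_of_continuous
      (f := fun (p : ℝ≥0 × ℝ≥0) (s : ℝ) => (rate (φ p.1 s.toNNReal) : ℝ))
      (s := fun p : ℝ≥0 × ℝ≥0 => (p.2 : ℝ)) ?_ (by fun_prop)
    have h : Continuous fun q : (ℝ≥0 × ℝ≥0) × ℝ => Function.uncurry φ (q.1.1, q.2.toNNReal) :=
      hφ.comp (by fun_prop)
    exact NNReal.continuous_coe.comp (hrate.comp h)
  have hdens : Measurable
      (Function.uncurry fun x t : ℝ≥0 => (jumpTimeDensity φ rate x t : ℝ≥0∞)) := by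
    have h : Continuous fun p : ℝ≥0 × ℝ≥0 => jumpTimeDensity φ rate p.1 p.2 := by
      unfold jumpTimeDensity
      exact (hrate.comp hφ).mul (by fun_prop)
    exact (ENNReal.continuous_coe.comp h).measurable
  have hmap : Measurable fun p : ℝ≥0 × ℝ≥0 => f (φ p.1 p.2) :=
    (f.continuous.comp hφ).measurable
  rw [jumpKernel, Kernel.map_apply _ hmap, Kernel.prod_apply, jumpTimeKernel,
    Kernel.withDensity_apply _ hdens, Kernel.id_apply, Kernel.const_apply, Measure.dirac_prod,
    Measure.map_map hmap (by fun_prop)]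
  rfl

/-- `Z` is, under `P`, the sequence of post-jump locations of the process started at `x₀`:
`Z₀ = x₀`, and given `Z₀, …, Z_k` the next location `Z_{k+1}` has law `𝒫_λ(Z_k, ·)`. -/
structure IsJumpChain {Ω : Type*} [MeasurableSpace Ω] (P : Measure Ω) (φ : ℝ≥0 → ℝ≥0 → ℝ≥0)
    (f : ℝ≥0 ≃o ℝ≥0) (rate : ℝ≥0 → ℝ≥0) (x₀ : ℝ≥0) (Z : ℕ → Ω → ℝ≥0) : Prop where
  measurable : ∀ k, Measurable (Z k)
  init : ∀ᵐ ω ∂P, Z 0 ω = x₀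
  transition : ∀ k, HasCondDistrib (Z (k + 1)) (fun ω (i : Finset.Iic k) => Z i ω)
    ((jumpKernel φ f rate).comap (fun h : Finset.Iic k → ℝ≥0 => h ⟨k, by simp⟩)
      (measurable_pi_apply _)) P

/-- The probability measure on `[0, ∞)` with density `p`. -/
noncomputable def densityMeasure (p : ℝ≥0 → ℝ≥0) : Measure ℝ≥0 :=
  halfLine.withDensity fun x => (p x : ℝ≥0∞)

/-- `p` is the density of the unique invariant probability measure of the kernel `K`. -/
structure IsUniqueInvariantDensity (K : Kernel ℝ≥0 ℝ≥0) (p : ℝ≥0 → ℝ≥0) : Prop where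
  measurable : Measurable p
  isProbabilityMeasure : IsProbabilityMeasure (densityMeasure p)
  invariant : K.Invariant (densityMeasure p)
  unique : ∀ π : Measure ℝ≥0, IsProbabilityMeasure π → K.Invariant π → π = densityMeasure p

/-- The function `𝕍(x) = exp (a / (b + 1) * f(x) ^ (b + 1))`. -/
noncomputable def V (f : ℝ≥0 ≃o ℝ≥0) (a b : ℝ) (x : ℝ≥0) : ℝ :=
  Real.exp (a / (b + 1) * (f x : ℝ) ^ (b + 1))

/-- The function `G_λ(z) = R / (1 - γ) * (𝕍(z) + ∫ 𝕍(x) ν_λ(x) dx)`, where `p = ν_λ`. -/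
noncomputable def G (f : ℝ≥0 ≃o ℝ≥0) (a b R γ : ℝ) (p : ℝ≥0 → ℝ≥0) (z : ℝ≥0) : ℝ :=
  R / (1 - γ) * (V f a b z + ∫ x, V f a b x * p x ∂halfLine)

/-- The sup norm of a (bounded) function. -/
noncomputable def supNorm (s : ℝ≥0 → ℝ) : ℝ := ⨆ x, |s x|

end PDMP

/-!
Two estimates hold uniformly over the class of jump rates. In the coordinate `u = f (φ x t)` the
hazard is `λ(f⁻¹(u)) g_x(u) du`. Since `g_x ≥ m`, beyond `f r` it is at least `a u ^ b du`, the
differential of `a / (b + 1) * u ^ (b + 1)`; together with `f x ≤ κ x` this makes `V` satisfy a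
geometric drift condition, and it bounds below the probability of jumping close to `f x`, so that
from a sublevel set of `V` the chain reaches `[0, r]` in a fixed number of steps with a probability
bounded below. Since `g_x ≤ M`, the hazard accumulated below `f r` is at most `L`, so the jump laws
from all points of `[0, r]` dominate a common measure whose mass does not depend on the rate.

Drift and minorization contract a weighted oscillation seminorm (Hairer and Mattingly), with a
factor that depends only on their constants. The jump laws have densities, and under the
contraction the densities of the iterates form a Cauchy sequence in `L¹`, whose limit is the
invariant density. In the variance, the covariance of `s (Z j)` and `s (Z k)` decays like
`γ ^ (k - j)`, and replacing the law of `Z j` by the invariant one costs a summable `γ ^ j`.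
-/

namespace PDMP

/-! ### Geometric contraction from drift and minorization -/

section Harris

variable {X : Type*} [MeasurableSpace X]

instance isMarkovKernel_pow (P : Kernel X X) [IsMarkovKernel P] (n : ℕ) :
    IsMarkovKernel (P ^ n) := by
  induction n with
  | zero => rw [pow_zero]; exact inferInstanceAs (IsMarkovKernel Kernel.id)
  | succ n ih => rw [pow_succ]; exact inferInstanceAs (IsMarkovKernel ((P ^ n) ∘ₖ P))

theorem pow_zero_kernel_apply (P : Kernel X X) (x : X) : (P ^ 0) x = Measure.dirac x := by
  rw [pow_zero]
  exact Kernel.id_apply x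

theorem measurable_integral_kernel (P : Kernel X X) [IsMarkovKernel P] {ψ : X → ℝ}
    (hψ : Measurable ψ) : Measurable fun x => ∫ z, ψ z ∂(P x) :=
  (StronglyMeasurable.integral_kernel (κ := P) (f := ψ) hψ.stronglyMeasurable).measurable

theorem integral_pow_add (P : Kernel X X) (m n : ℕ) {ψ : X → ℝ} {x : X}
    (h : Integrable ψ ((P ^ (m + n)) x)) :
    ∫ z, ψ z ∂((P ^ (m + n)) x) = ∫ y, ∫ z, ψ z ∂((P ^ m) y) ∂((P ^ n) x) := by
  rw [Kernel.pow_add] at h ⊢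
  exact Kernel.integral_comp h

theorem integrable_of_abs_le {μ : Measure X} {W ψ : X → ℝ} (hW : Integrable W μ)
    (hψ : Measurable ψ) (h : ∀ z, |ψ z| ≤ W z) : Integrable ψ μ :=
  hW.mono' hψ.aestronglyMeasurable (ae_of_all _ h)

theorem abs_integral_le_of_abs_le {μ : Measure X} {W ψ : X → ℝ} (hW : Integrable W μ)
    (h : ∀ z, |ψ z| ≤ W z) : |∫ z, ψ z ∂μ| ≤ ∫ z, W z ∂μ :=
  norm_integral_le_of_norm_le (f := ψ) hW (ae_of_all _ h)

theorem integrable_and_integral_le {μ : Measure X} {W : X → ℝ} {B : ℝ} (hW : Measurable W)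
    (hW0 : ∀ x, 0 ≤ W x) (hB : 0 ≤ B)
    (h : ∫⁻ x, ENNReal.ofReal (W x) ∂μ ≤ ENNReal.ofReal B) :
    Integrable W μ ∧ ∫ x, W x ∂μ ≤ B := by
  refine ⟨(lintegral_ofReal_ne_top_iff_integrable hW.aestronglyMeasurable (ae_of_all _ hW0)).1
    (h.trans_lt ENNReal.ofReal_lt_top).ne, ?_⟩
  rw [integral_eq_lintegral_of_nonneg_ae (ae_of_all _ hW0) hW.aestronglyMeasurable]
  exact ENNReal.toReal_le_of_le_ofReal hB h

theorem abs_integral_sub_integral_le_of_le {μ ν : Measure X} {ψ W : X → ℝ} (hμν : μ ≤ ν)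
    (hW : Integrable W ν) (hψ : Measurable ψ) (h : ∀ z, |ψ z| ≤ W z) :
    |∫ z, ψ z ∂ν - ∫ z, ψ z ∂μ| ≤ ∫ z, W z ∂ν - ∫ z, W z ∂μ := by
  have hψν : Integrable ψ ν := integrable_of_abs_le hW hψ h
  have hadd := integral_mono_measure hμν
    (ae_of_all ν fun z => show 0 ≤ W z + ψ z by linarith [(abs_le.1 (h z)).1]) (hW.add hψν)
  have hsub := integral_mono_measure hμν
    (ae_of_all ν fun z => show 0 ≤ W z - ψ z by linarith [(abs_le.1 (h z)).2]) (hW.sub hψν)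
  rw [integral_add (hW.mono_measure hμν) (hψν.mono_measure hμν), integral_add hW hψν] at hadd
  rw [integral_sub (hW.mono_measure hμν) (hψν.mono_measure hμν), integral_sub hW hψν] at hsub
  exact abs_le.2 ⟨by linarith, by linarith⟩

theorem abs_integral_sub_integral_le_of_minorization {μ ν₁ ν₂ : Measure X} {ψ W : X → ℝ}
    (h₁ : μ ≤ ν₁) (h₂ : μ ≤ ν₂) (hW₁ : Integrable W ν₁) (hW₂ : Integrable W ν₂)
    (hψ : Measurable ψ) (h : ∀ z, |ψ z| ≤ W z) :
    |∫ z, ψ z ∂ν₁ - ∫ z, ψ z ∂ν₂| ≤ ∫ z, W z ∂ν₁ + ∫ z, W z ∂ν₂ - 2 * ∫ z, W z ∂μ := by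
  have hν₁ := abs_le.1 (abs_integral_sub_integral_le_of_le h₁ hW₁ hψ h)
  have hν₂ := abs_le.1 (abs_integral_sub_integral_le_of_le h₂ hW₂ hψ h)
  exact abs_le.2 ⟨by linarith, by linarith⟩

theorem exists_center {X : Type*} [Nonempty X] {u w : X → ℝ}
    (h : ∀ x y, |u x - u y| ≤ w x + w y) : ∃ c, ∀ x, |u x - c| ≤ w x := by
  obtain ⟨x₀⟩ := ‹Nonempty X›
  have hbdd : BddAbove (range fun x => u x - w x) :=
    ⟨u x₀ + w x₀, forall_mem_range.2 fun x => by linarith [(abs_le.1 (h x x₀)).2]⟩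
  refine ⟨⨆ x, (u x - w x), fun x => abs_le.2 ⟨?_, by linarith [le_ciSup hbdd x]⟩⟩
  have : Nonempty X := ⟨x₀⟩
  have hle : ⨆ x, (u x - w x) ≤ u x + w x :=
    ciSup_le fun y => by linarith [(abs_le.1 (h y x)).2]
  linarith

/-- The geometric drift (Foster–Lyapunov) condition `P V ≤ η V + C` for a nonnegative function
`V`. With the Lebesgue integral it includes the finiteness of `P V`. -/
def GeometricDrift (P : Kernel X X) (V : X → ℝ) (η C : ℝ) : Prop :=
  ∀ x, ∫⁻ z, ENNReal.ofReal (V z) ∂(P x) ≤ ENNReal.ofReal (η * V x + C)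

section Drift

variable {P : Kernel X X} {V : X → ℝ} {η C : ℝ}

theorem GeometricDrift.integrable_and_integral_le (h : GeometricDrift P V η C)
    (hV : Measurable V) (hV0 : ∀ x, 0 ≤ V x) (hη : 0 ≤ η) (hC : 0 ≤ C) (x : X) :
    Integrable V (P x) ∧ ∫ z, V z ∂(P x) ≤ η * V x + C :=
  PDMP.integrable_and_integral_le hV hV0 (add_nonneg (mul_nonneg hη (hV0 x)) hC) (h x)

theorem GeometricDrift.pow [IsMarkovKernel P] (h : GeometricDrift P V η C) (hV : Measurable V)
    (hV0 : ∀ x, 0 ≤ V x) (hη0 : 0 ≤ η) (hη : η < 1) (hC : 0 ≤ C) (n : ℕ) :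
    GeometricDrift (P ^ n) V (η ^ n) (C / (1 - η)) := by
  have h1η : 0 < 1 - η := sub_pos.2 hη
  induction n with
  | zero =>
    intro x
    rw [pow_zero_kernel_apply, lintegral_dirac' x hV.ennreal_ofReal, pow_zero, one_mul]
    exact ENNReal.ofReal_le_ofReal (le_add_of_nonneg_right (by positivity))
  | succ n ih =>
    intro x
    calc ∫⁻ z, ENNReal.ofReal (V z) ∂((P ^ (n + 1)) x)
        = ∫⁻ y, ∫⁻ z, ENNReal.ofReal (V z) ∂(P y) ∂((P ^ n) x) := by
          rw [pow_succ']
          exact Kernel.lintegral_comp P (P ^ n) x hV.ennreal_ofReal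
      _ ≤ ∫⁻ y, (ENNReal.ofReal η * ENNReal.ofReal (V y) + ENNReal.ofReal C) ∂((P ^ n) x) := by
          refine lintegral_mono fun y => (h y).trans_eq ?_
          rw [ENNReal.ofReal_add (mul_nonneg hη0 (hV0 y)) hC, ENNReal.ofReal_mul hη0]
      _ = ENNReal.ofReal η * ∫⁻ y, ENNReal.ofReal (V y) ∂((P ^ n) x) + ENNReal.ofReal C := by
          rw [lintegral_add_right _ measurable_const, lintegral_const_mul _ hV.ennreal_ofReal,
            lintegral_const, measure_univ, mul_one]
      _ ≤ ENNReal.ofReal η * ENNReal.ofReal (η ^ n * V x + C / (1 - η)) + ENNReal.ofReal C := by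
          gcongr
          exact ih x
      _ = ENNReal.ofReal (η ^ (n + 1) * V x + C / (1 - η)) := by
          have := hV0 x
          rw [← ENNReal.ofReal_mul hη0, ← ENNReal.ofReal_add (by positivity) hC, pow_succ']
          congr 1
          field_simp
          ring

theorem GeometricDrift.mono {η' : ℝ} (h : GeometricDrift P V η C) (hV0 : ∀ x, 0 ≤ V x)
    (hη : η ≤ η') : GeometricDrift P V η' C := fun x =>
  (h x).trans (ENNReal.ofReal_le_ofReal
    (by gcongr; exact hV0 x))

end Drift

/-- The Harris condition: `V` satisfies a geometric drift condition with respect to `P`, and on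
the sublevel set `{V ≤ d}` the `N`-step kernel dominates a common measure of mass at least `ε`. -/
structure IsHarris (P : Kernel X X) (V : X → ℝ) (η C ε d : ℝ) (N : ℕ) : Prop where
  measurable : Measurable V
  one_le : ∀ x, 1 ≤ V x
  eta_nonneg : 0 ≤ η
  eta_lt_one : η < 1
  const_nonneg : 0 ≤ C
  drift : GeometricDrift P V η C
  steps_pos : 0 < N
  minorization : ∃ μ : Measure X, ENNReal.ofReal ε ≤ μ univ ∧ ∀ x, V x ≤ d → μ ≤ (P ^ N) x

/-- `β` is a weight and `ρ` a rate for which a Markov kernel with `P V ≤ η V + C` and a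
minorization of mass `ε` on `{V ≤ d}` contracts the oscillation seminorm with weight `1 + β V` by
the factor `ρ`; here `s` stands for `V x + V y`. -/
structure IsContractionRate (η C ε d β ρ : ℝ) : Prop where
  weight_pos : 0 < β
  rate_pos : 0 < ρ
  rate_lt_one : ρ < 1
  le_of_minorization : ∀ s, 0 ≤ s → 2 + β * (η * s + 2 * C) - 2 * ε ≤ ρ * (2 + β * s)
  le_of_drift : ∀ s, d ≤ s → 2 + β * (η * s + 2 * C) ≤ ρ * (2 + β * s)

theorem exists_isContractionRate {η C ε d : ℝ} (hη : η < 1) (hC : 0 < C) (hε : 0 < ε)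
    (hε1 : ε ≤ 1) (hd : 2 * C < (1 - η) * d) :
    ∃ β ρ, IsContractionRate η C ε d β ρ := by
  have hd0 : 0 < d := pos_of_mul_pos_right (lt_trans (by positivity) hd) (by linarith)
  obtain ⟨β, hβ, hβC⟩ : ∃ β : ℝ, 0 < β ∧ 2 * β * C = ε :=
    ⟨ε / (2 * C), by positivity, by field_simp⟩
  have hden : 0 < 2 + β * d := by positivity
  set ρ₁ := (2 + β * (η * d + 2 * C)) / (2 + β * d) with hρ₁
  have hρ₁d : ρ₁ * (2 + β * d) = 2 + β * (η * d + 2 * C) := div_mul_cancel₀ _ hden.ne'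
  have hρ₁1 : ρ₁ < 1 := by
    rw [hρ₁, div_lt_one hden]
    linarith [mul_lt_mul_of_pos_left (show η * d + 2 * C < d by linarith) hβ]
  set ρ := max (max (1 - ε / 2) η) ρ₁
  have hερ : 1 - ε / 2 ≤ ρ := le_max_of_le_left (le_max_left _ _)
  have hηρ : η ≤ ρ := le_max_of_le_left (le_max_right _ _)
  have hρ₁ρ : ρ₁ ≤ ρ := le_max_right _ _
  refine ⟨β, ρ, hβ, by linarith, max_lt (max_lt (by linarith) hη) hρ₁1, fun s hs => ?_,
    fun s hs => ?_⟩
  · linarith [mul_le_mul_of_nonneg_right hηρ (mul_nonneg hβ.le hs)]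
  · have hslope : 0 ≤ (ρ - η) * (β * (s - d)) :=
      mul_nonneg (sub_nonneg.2 hηρ) (mul_nonneg hβ.le (sub_nonneg.2 hs))
    linarith [mul_le_mul_of_nonneg_right hρ₁ρ hden.le]

theorem integral_affine_le_of_drift {Q : Kernel X X} [IsMarkovKernel Q] {V : X → ℝ}
    {η C β K : ℝ} {x : X} (h : Integrable V (Q x) ∧ ∫ z, V z ∂(Q x) ≤ η * V x + C)
    (hβ : 0 ≤ β) (hK : 0 ≤ K) :
    Integrable (fun z => K * (1 + β * V z)) (Q x) ∧
      ∫ z, K * (1 + β * V z) ∂(Q x) ≤ K * (1 + β * (η * V x + C)) := by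
  refine ⟨((integrable_const 1).add (h.1.const_mul β)).const_mul K, ?_⟩
  rw [integral_const_mul, integral_add (integrable_const 1) (h.1.const_mul β), integral_const_mul,
    integral_const, probReal_univ, one_smul]
  gcongr
  exact h.2

theorem mul_le_integral_of_ofReal_le_measure_univ {μ : Measure X} [IsFiniteMeasure μ]
    {W : X → ℝ} {ε K : ℝ} (hμ : ENNReal.ofReal ε ≤ μ univ) (hK : 0 ≤ K) (hW : Integrable W μ)
    (h : ∀ z, K ≤ W z) : K * ε ≤ ∫ z, W z ∂μ :=
  calc K * ε ≤ K * μ.real univ :=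
        mul_le_mul_of_nonneg_left (ENNReal.ofReal_le_iff_le_toReal (measure_ne_top μ univ) |>.1 hμ)
          hK
    _ = ∫ _, K ∂μ := by rw [integral_const, smul_eq_mul, mul_comm]
    _ ≤ ∫ z, W z ∂μ := integral_mono (integrable_const K) hW h

theorem GeometricDrift.abs_integral_sub_integral_le {Q : Kernel X X} [IsMarkovKernel Q]
    {V : X → ℝ} {μ : Measure X} {η C ε d β ρ K : ℝ} (hQ : GeometricDrift Q V η C)
    (hV : Measurable V) (hV0 : ∀ x, 0 ≤ V x) (hη : 0 ≤ η) (hC : 0 ≤ C)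
    (hμ : ENNReal.ofReal ε ≤ μ univ) (hμQ : ∀ x, V x ≤ d → μ ≤ Q x)
    (hρ : IsContractionRate η C ε d β ρ) (hK : 0 ≤ K) {ψ : X → ℝ} (hψ : Measurable ψ)
    (hψK : ∀ x y, |ψ x - ψ y| ≤ K * (2 + β * (V x + V y))) (x y : X) :
    |∫ z, ψ z ∂(Q x) - ∫ z, ψ z ∂(Q y)| ≤ ρ * K * (2 + β * (V x + V y)) := by
  have hβ := hρ.weight_pos.le
  obtain ⟨c, hc⟩ : ∃ c, ∀ z, |ψ z - c| ≤ K * (1 + β * V z) :=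
    have : Nonempty X := ⟨x⟩
    exists_center fun z z' => (hψK z z').trans_eq (by ring)
  have hVQ := hQ.integrable_and_integral_le hV hV0 hη hC
  have hW := fun z => integral_affine_le_of_drift (hVQ z) hβ hK
  have hcenter : ∀ z, ∫ z, ψ z ∂(Q z) - c = ∫ z', (ψ z' - c) ∂(Q z) := fun z => by
    have hsub := integrable_of_abs_le (hW z).1 (hψ.sub_const c) hc
    have hψz : Integrable ψ (Q z) := by
      simpa only [Pi.add_def, sub_add_cancel] using hsub.add (integrable_const c)
    rw [integral_sub hψz (integrable_const c), integral_const, probReal_univ, one_smul]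
  rw [← sub_sub_sub_cancel_right _ _ c, hcenter, hcenter]
  rcases le_total (V x + V y) d with hxy | hxy
  · have hμx := hμQ x (by linarith [hV0 y])
    have hμy := hμQ y (by linarith [hV0 x])
    have : IsFiniteMeasure μ := isFiniteMeasure_of_le (Q x) hμx
    have hmass := mul_le_integral_of_ofReal_le_measure_univ hμ hK ((hW x).1.mono_measure hμx)
      fun z => le_mul_of_one_le_right hK (le_add_of_nonneg_right (mul_nonneg hβ (hV0 z)))
    have hcouple := abs_integral_sub_integral_le_of_minorization hμx hμy (hW x).1 (hW y).1
      (hψ.sub_const c) hc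
    have hrate := mul_le_mul_of_nonneg_left
      (hρ.le_of_minorization (V x + V y) (add_nonneg (hV0 x) (hV0 y))) hK
    linarith [(hW x).2, (hW y).2]
  · have hx := (abs_integral_le_of_abs_le (hW x).1 hc).trans (hW x).2
    have hy := (abs_integral_le_of_abs_le (hW y).1 hc).trans (hW y).2
    have hrate := mul_le_mul_of_nonneg_left (hρ.le_of_drift (V x + V y) hxy) hK
    linarith [abs_sub (∫ z, (ψ z - c) ∂(Q x)) (∫ z, (ψ z - c) ∂(Q y))]

/-- The iterates of `P` bring the integrals of every function dominated by `V` together at a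
geometric rate. -/
def GeometricOscillation (P : Kernel X X) (V : X → ℝ) (R γ : ℝ) : Prop :=
  ∀ ψ : X → ℝ, Measurable ψ → (∀ z, |ψ z| ≤ V z) → ∀ (n : ℕ) (x y : X),
    |∫ z, ψ z ∂((P ^ n) x) - ∫ z, ψ z ∂((P ^ n) y)| ≤ R * γ ^ n * (V x + V y)

section Decay

variable {P : Kernel X X} {V : X → ℝ} {η C ε d : ℝ} {N : ℕ} {ψ : X → ℝ}

theorem IsHarris.nonneg (h : IsHarris P V η C ε d N) (x : X) : 0 ≤ V x :=
  zero_le_one.trans (h.one_le x)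

theorem IsHarris.drift_const_nonneg (h : IsHarris P V η C ε d N) : 0 ≤ C / (1 - η) :=
  div_nonneg h.const_nonneg (sub_nonneg.2 h.eta_lt_one.le)

variable [IsMarkovKernel P]

theorem IsHarris.pow_drift (h : IsHarris P V η C ε d N) (n : ℕ) :
    GeometricDrift (P ^ n) V (η ^ n) (C / (1 - η)) :=
  h.drift.pow h.measurable h.nonneg h.eta_nonneg h.eta_lt_one h.const_nonneg n

theorem IsHarris.integrable_pow (h : IsHarris P V η C ε d N) (n : ℕ) (x : X) :
    Integrable V ((P ^ n) x) :=
  ((h.pow_drift n).integrable_and_integral_le h.measurable h.nonneg (pow_nonneg h.eta_nonneg n)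
    h.drift_const_nonneg x).1

theorem IsHarris.integral_pow_le (h : IsHarris P V η C ε d N) (n : ℕ) (x : X) :
    ∫ z, V z ∂((P ^ n) x) ≤ V x + C / (1 - η) :=
  ((h.pow_drift n).integrable_and_integral_le h.measurable h.nonneg (pow_nonneg h.eta_nonneg n)
    h.drift_const_nonneg x).2.trans
    (by gcongr; exact mul_le_of_le_one_left (h.nonneg x) (pow_le_one₀ h.eta_nonneg h.eta_lt_one.le))

theorem IsHarris.abs_integral_pow_sub_le_of_rate {β ρ K : ℝ} (h : IsHarris P V η C ε d N)
    (hρ : IsContractionRate η (C / (1 - η)) ε d β ρ) (hK : 0 ≤ K) (hψ : Measurable ψ)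
    (hψV : ∀ z, |ψ z| ≤ V z) {j : ℕ}
    (hj : ∀ x y, |∫ z, ψ z ∂((P ^ j) x) - ∫ z, ψ z ∂((P ^ j) y)| ≤ K * (2 + β * (V x + V y)))
    (k : ℕ) (x y : X) :
    |∫ z, ψ z ∂((P ^ (j + N * k)) x) - ∫ z, ψ z ∂((P ^ (j + N * k)) y)| ≤
      ρ ^ k * K * (2 + β * (V x + V y)) := by
  obtain ⟨μ, hμ, hμP⟩ := h.minorization
  have hdrift : GeometricDrift (P ^ N) V η (C / (1 - η)) :=
    (h.pow_drift N).mono h.nonneg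
      (pow_le_of_le_one h.eta_nonneg h.eta_lt_one.le h.steps_pos.ne')
  induction k generalizing x y with
  | zero => simpa using hj x y
  | succ k ih =>
    have hsplit : ∀ x, ∫ z, ψ z ∂((P ^ (j + N * (k + 1))) x) =
        ∫ y, ∫ z, ψ z ∂((P ^ (j + N * k)) y) ∂((P ^ N) x) := fun x => by
      rw [mul_add_one, ← add_assoc]
      exact integral_pow_add P _ N (integrable_of_abs_le (h.integrable_pow _ x) hψ hψV)
    have hρk : 0 ≤ ρ ^ k * K := mul_nonneg (pow_nonneg hρ.rate_pos.le k) hK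
    rw [hsplit, hsplit, pow_succ', mul_assoc ρ]
    exact hdrift.abs_integral_sub_integral_le h.measurable h.nonneg h.eta_nonneg
      h.drift_const_nonneg hμ hμP hρ hρk (measurable_integral_kernel _ hψ) ih x y

theorem IsHarris.abs_integral_pow_sub_le {β : ℝ} (h : IsHarris P V η C ε d N) (hβ : 0 < β)
    (hψV : ∀ z, |ψ z| ≤ V z) (j : ℕ) (x y : X) :
    |∫ z, ψ z ∂((P ^ j) x) - ∫ z, ψ z ∂((P ^ j) y)| ≤
      (1 + C / (1 - η)) / β * (2 + β * (V x + V y)) := by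
  have hC := h.drift_const_nonneg
  have hx := (abs_integral_le_of_abs_le (h.integrable_pow j x) hψV).trans (h.integral_pow_le j x)
  have hy := (abs_integral_le_of_abs_le (h.integrable_pow j y) hψV).trans (h.integral_pow_le j y)
  have hCV := mul_le_mul_of_nonneg_left (add_le_add (h.one_le x) (h.one_le y)) hC
  calc |∫ z, ψ z ∂((P ^ j) x) - ∫ z, ψ z ∂((P ^ j) y)|
      ≤ |∫ z, ψ z ∂((P ^ j) x)| + |∫ z, ψ z ∂((P ^ j) y)| := abs_sub _ _
    _ ≤ (1 + C / (1 - η)) / β * (β * (V x + V y)) := by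
        rw [← mul_assoc, div_mul_cancel₀ _ hβ.ne']
        linarith
    _ ≤ (1 + C / (1 - η)) / β * (2 + β * (V x + V y)) := by
        gcongr
        linarith

theorem pow_div_le_div_of_pow_eq {γ ρ : ℝ} (hγ0 : 0 < γ) (hγ1 : γ ≤ 1) (hN : 0 < N)
    (hγN : γ ^ N = ρ) (n : ℕ) : ρ ^ (n / N) ≤ γ ^ n / ρ := by
  have hρ : 0 < ρ := hγN ▸ pow_pos hγ0 N
  rw [le_div_iff₀ hρ, ← pow_succ, ← hγN, ← pow_mul]
  exact pow_le_pow_of_le_one hγ0.le hγ1 (Nat.lt_mul_div_succ n hN).le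

theorem IsHarris.geometricOscillation {β ρ γ : ℝ} (h : IsHarris P V η C ε d N)
    (hρ : IsContractionRate η (C / (1 - η)) ε d β ρ) (hγ0 : 0 < γ) (hγ1 : γ ≤ 1)
    (hγN : γ ^ N = ρ) :
    GeometricOscillation P V ((1 + C / (1 - η)) / β / ρ * (1 + β)) γ := by
  intro ψ hψ hψV n x y
  have hβ := hρ.weight_pos
  have hK : 0 ≤ (1 + C / (1 - η)) / β :=
    div_nonneg (add_nonneg zero_le_one h.drift_const_nonneg) hβ.le
  have hdecay := h.abs_integral_pow_sub_le_of_rate hρ hK hψ hψV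
    (h.abs_integral_pow_sub_le hβ hψV (n % N)) (n / N) x y
  rw [Nat.mod_add_div] at hdecay
  have hV := add_nonneg (h.nonneg x) (h.nonneg y)
  calc _ ≤ ρ ^ (n / N) * ((1 + C / (1 - η)) / β) * (2 + β * (V x + V y)) := hdecay
    _ ≤ γ ^ n / ρ * ((1 + C / (1 - η)) / β) * ((1 + β) * (V x + V y)) := by
        have hpow := pow_div_le_div_of_pow_eq hγ0 hγ1 h.steps_pos hγN n
        have hweight : 2 + β * (V x + V y) ≤ (1 + β) * (V x + V y) := by
          linarith [h.one_le x, h.one_le y]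
        gcongr
        exact mul_nonneg (div_nonneg (pow_nonneg hγ0.le n) hρ.rate_pos.le) hK
    _ = (1 + C / (1 - η)) / β / ρ * (1 + β) * γ ^ n * (V x + V y) := by ring

end Decay

end Harris

/-! ### Existence and uniqueness of the invariant density -/

section Invariant

open Filter Topology

variable {X : Type*} [MeasurableSpace X] {P : Kernel X X}

theorem invariant_pow {π : Measure X} (h : P.Invariant π) (n : ℕ) : (P ^ n).Invariant π := by
  induction n with
  | zero => rw [pow_zero]; exact Measure.id_comp
  | succ n ih => rw [pow_succ]; exact ih.comp h

theorem integral_bind_kernel {μ : Measure X} {ψ : X → ℝ} (h : Integrable ψ (μ.bind P)) :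
    ∫ z, ψ z ∂(μ.bind P) = ∫ y, ∫ z, ψ z ∂(P y) ∂μ := by
  have hbind : μ.bind P = (P ∘ₖ Kernel.const Unit μ) () := Measure.comp_eq_comp_const_apply
  rw [hbind] at h ⊢
  rw [Kernel.integral_comp h, Kernel.const_apply]

theorem integral_integral_pow_of_invariant {π : Measure X} (h : P.Invariant π) (n : ℕ)
    {ψ : X → ℝ} (hψ : Integrable ψ π) : ∫ y, ∫ z, ψ z ∂((P ^ n) y) ∂π = ∫ z, ψ z ∂π := by
  have hn : π.bind (P ^ n) = π := invariant_pow h n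
  rw [← integral_bind_kernel (hn.symm ▸ hψ), hn]

theorem lintegral_lintegral_pow_of_invariant {π : Measure X} (h : P.Invariant π) (n : ℕ)
    {g : X → ℝ≥0∞} (hg : Measurable g) : ∫⁻ y, ∫⁻ z, g z ∂((P ^ n) y) ∂π = ∫⁻ z, g z ∂π := by
  have hn : π.bind (P ^ n) = π := invariant_pow h n
  conv_rhs => rw [← hn]
  exact (Measure.lintegral_bind (P ^ n).aemeasurable hg.aemeasurable).symm

theorem lintegral_eq_iSup_lintegral_min_natCast {μ : Measure X} {g : X → ℝ≥0∞}
    (hg : Measurable g) : ∫⁻ x, g x ∂μ = ⨆ m : ℕ, ∫⁻ x, min (g x) m ∂μ := by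
  rw [← lintegral_iSup (fun m => hg.min measurable_const)
    fun m m' hm x => min_le_min_left _ (by exact_mod_cast hm)]
  refine lintegral_congr fun x => ?_
  rw [← inf_iSup_eq, ENNReal.iSup_natCast, inf_top_eq]

section Moment

variable [IsMarkovKernel P] {V : X → ℝ} {η C ε d : ℝ} {N : ℕ} {π : Measure X}
  [IsProbabilityMeasure π]

theorem IsHarris.lintegral_min_le_of_invariant (h : IsHarris P V η C ε d N)
    (hπ : P.Invariant π) (m : ℕ) :
    ∫⁻ z, min (ENNReal.ofReal (V z)) m ∂π ≤ ENNReal.ofReal (C / (1 - η)) := by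
  have hiter : ∀ n : ℕ, ∫⁻ z, min (ENNReal.ofReal (V z)) m ∂π ≤
      ∫⁻ y, min (ENNReal.ofReal (η ^ n * V y + C / (1 - η))) m ∂π := fun n => by
    rw [← lintegral_lintegral_pow_of_invariant hπ n
      (h.measurable.ennreal_ofReal.min measurable_const)]
    refine lintegral_mono fun y => le_min ?_ ?_
    · exact (lintegral_mono fun z => min_le_left _ _).trans (h.pow_drift n y)
    · refine (lintegral_mono fun z => min_le_right _ _).trans_eq ?_
      rw [lintegral_const, measure_univ, mul_one]
  have hlim : Tendsto (fun n : ℕ => ∫⁻ y, min (ENNReal.ofReal (η ^ n * V y + C / (1 - η))) m ∂π)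
      atTop (𝓝 (∫⁻ _, min (ENNReal.ofReal (C / (1 - η))) m ∂π)) := by
    refine tendsto_lintegral_of_dominated_convergence (fun _ => m) (fun n =>
      ((h.measurable.const_mul _).add_const _).ennreal_ofReal.min measurable_const)
      (fun n => ae_of_all _ fun y => min_le_right _ _) (by simp) (ae_of_all _ fun y => ?_)
    have hpow := tendsto_pow_atTop_nhds_zero_of_lt_one h.eta_nonneg h.eta_lt_one
    have hV := (hpow.mul_const (V y)).add_const (C / (1 - η))
    rw [zero_mul, zero_add] at hV
    exact (ENNReal.tendsto_ofReal hV).min tendsto_const_nhds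
  refine (ge_of_tendsto' hlim hiter).trans ?_
  rw [lintegral_const, measure_univ, mul_one]
  exact min_le_left _ _

theorem IsHarris.integrable_and_integral_le_of_invariant (h : IsHarris P V η C ε d N)
    (hπ : P.Invariant π) : Integrable V π ∧ ∫ x, V x ∂π ≤ C / (1 - η) := by
  refine PDMP.integrable_and_integral_le h.measurable h.nonneg h.drift_const_nonneg ?_
  rw [lintegral_eq_iSup_lintegral_min_natCast h.measurable.ennreal_ofReal]
  exact iSup_le (h.lintegral_min_le_of_invariant hπ)

end Moment

theorem measure_eq_of_integral_indicator {μ ν : Measure X} [IsFiniteMeasure μ]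
    [IsFiniteMeasure ν]
    (h : ∀ A, MeasurableSet A → ∫ z, A.indicator 1 z ∂μ = ∫ z, A.indicator (1 : X → ℝ) z ∂ν) :
    μ = ν := by
  ext A hA
  have hμν := h A hA
  rw [integral_indicator_one hA, integral_indicator_one hA] at hμν
  exact (measureReal_eq_measureReal_iff).1 hμν

theorem abs_indicator_one_le {X : Type*} (A : Set X) (z : X) :
    |A.indicator (1 : X → ℝ) z| ≤ 1 := by
  by_cases h : z ∈ A <;> simp [h]

section Oscillation

variable [IsMarkovKernel P] {V : X → ℝ} {R γ : ℝ}

theorem GeometricOscillation.abs_integral_sub_integral_integral_le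
    (hosc : GeometricOscillation P V R γ) {π : Measure X} [IsProbabilityMeasure π]
    (hVπ : Integrable V π) {ψ : X → ℝ} (hψ : Measurable ψ) (hψV : ∀ z, |ψ z| ≤ V z) (n : ℕ)
    (x : X) :
    |∫ z, ψ z ∂((P ^ n) x) - ∫ y, ∫ z, ψ z ∂((P ^ n) y) ∂π| ≤
      R * γ ^ n * (V x + ∫ z, V z ∂π) := by
  set c := ∫ z, ψ z ∂((P ^ n) x)
  have hbound : Integrable (fun y => R * γ ^ n * (V x + V y)) π :=
    ((integrable_const (V x)).add hVπ).const_mul _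
  have hsub : Integrable (fun y => c - ∫ z, ψ z ∂((P ^ n) y)) π :=
    integrable_of_abs_le hbound ((measurable_integral_kernel _ hψ).const_sub c)
      (hosc ψ hψ hψV n x)
  have hint : Integrable (fun y => ∫ z, ψ z ∂((P ^ n) y)) π := by
    simpa only [Pi.sub_def, sub_sub_cancel] using (integrable_const c).sub hsub
  calc |c - ∫ y, ∫ z, ψ z ∂((P ^ n) y) ∂π| = |∫ y, (c - ∫ z, ψ z ∂((P ^ n) y)) ∂π| := by
        rw [integral_sub (integrable_const c) hint, integral_const, probReal_univ, one_smul]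
    _ ≤ ∫ y, R * γ ^ n * (V x + V y) ∂π := abs_integral_le_of_abs_le hbound (hosc ψ hψ hψV n x)
    _ = R * γ ^ n * (V x + ∫ z, V z ∂π) := by
        rw [integral_const_mul, integral_add (integrable_const _) hVπ, integral_const,
          probReal_univ, one_smul]

theorem GeometricOscillation.abs_sub_invariant_le (hosc : GeometricOscillation P V R γ)
    {π : Measure X} [IsProbabilityMeasure π] (hπ : P.Invariant π) (hVπ : Integrable V π)
    {ψ : X → ℝ} (hψ : Measurable ψ) (hψV : ∀ z, |ψ z| ≤ V z) (n : ℕ) (x : X) :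
    |∫ z, ψ z ∂((P ^ n) x) - ∫ z, ψ z ∂π| ≤ R * γ ^ n * (V x + ∫ z, V z ∂π) := by
  rw [← integral_integral_pow_of_invariant hπ n (integrable_of_abs_le hVπ hψ hψV)]
  exact hosc.abs_integral_sub_integral_integral_le hVπ hψ hψV n x

theorem GeometricOscillation.tendsto_integral_pow (hosc : GeometricOscillation P V R γ)
    (hγ0 : 0 ≤ γ) (hγ : γ < 1) {π : Measure X} [IsProbabilityMeasure π] (hπ : P.Invariant π)
    (hVπ : Integrable V π) {ψ : X → ℝ} (hψ : Measurable ψ) (hψV : ∀ z, |ψ z| ≤ V z) (x : X) :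
    Tendsto (fun n => ∫ z, ψ z ∂((P ^ n) x)) atTop (𝓝 (∫ z, ψ z ∂π)) := by
  refine tendsto_iff_norm_sub_tendsto_zero.2 (squeeze_zero (fun _ => norm_nonneg _)
    (fun n => hosc.abs_sub_invariant_le hπ hVπ hψ hψV n x) ?_)
  simpa using ((tendsto_pow_atTop_nhds_zero_of_lt_one hγ0 hγ).const_mul R).mul_const
    (V x + ∫ z, V z ∂π)

theorem GeometricOscillation.invariant_unique (hosc : GeometricOscillation P V R γ)
    (hγ0 : 0 ≤ γ) (hγ : γ < 1) (hV1 : ∀ x, 1 ≤ V x) {π π' : Measure X} [IsProbabilityMeasure π]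
    [IsProbabilityMeasure π'] (hπ : P.Invariant π) (hπ' : P.Invariant π')
    (hVπ : Integrable V π) (hVπ' : Integrable V π') : π = π' := by
  refine measure_eq_of_integral_indicator fun A hA => ?_
  obtain ⟨x⟩ : Nonempty X := π.nonempty_of_neZero
  have hmeas : Measurable (A.indicator (1 : X → ℝ)) := measurable_one.indicator hA
  have hle : ∀ z, |A.indicator (1 : X → ℝ) z| ≤ V z := fun z =>
    (abs_indicator_one_le A z).trans (hV1 z)
  exact tendsto_nhds_unique (hosc.tendsto_integral_pow hγ0 hγ hπ hVπ hmeas hle x)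
    (hosc.tendsto_integral_pow hγ0 hγ hπ' hVπ' hmeas hle x)

theorem GeometricOscillation.abs_integral_pow_succ_sub_le (hosc : GeometricOscillation P V R γ)
    {x : X} (hVx : Integrable V (P x)) {ψ : X → ℝ} (hψ : Measurable ψ)
    (hψ1 : ∀ z, |ψ z| ≤ 1) (hV1 : ∀ z, 1 ≤ V z) (n : ℕ) :
    |∫ z, ψ z ∂((P ^ (n + 1)) x) - ∫ z, ψ z ∂((P ^ n) x)| ≤
      R * γ ^ n * (V x + ∫ z, V z ∂(P x)) := by
  rw [abs_sub_comm, integral_pow_add P n 1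
    (integrable_of_abs_le (integrable_const 1) hψ hψ1), pow_one]
  exact hosc.abs_integral_sub_integral_integral_le hVx hψ (fun z => (hψ1 z).trans (hV1 z)) n x

end Oscillation

section Density

variable {ref : Measure X}

/-- The real-valued density of `μ` with respect to `ref`. -/
noncomputable def realDensity (μ ref : Measure X) (z : X) : ℝ := (μ.rnDeriv ref z).toReal

theorem measurable_realDensity {μ ref : Measure X} : Measurable (realDensity μ ref) :=
  (Measure.measurable_rnDeriv μ ref).ennreal_toReal

theorem integrable_realDensity {μ ref : Measure X} [IsFiniteMeasure μ] :
    Integrable (realDensity μ ref) ref :=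
  Measure.integrable_toReal_rnDeriv

theorem integral_abs_realDensity_sub_le [SigmaFinite ref] {μ ν : Measure X} [IsFiniteMeasure μ]
    [IsFiniteMeasure ν] (hμ : μ ≪ ref) (hν : ν ≪ ref) {B : ℝ}
    (h : ∀ ψ : X → ℝ, Measurable ψ → (∀ z, |ψ z| ≤ 1) → |∫ z, ψ z ∂μ - ∫ z, ψ z ∂ν| ≤ B) :
    ∫ z, |realDensity μ ref z - realDensity ν ref z| ∂ref ≤ B := by
  set sgn : X → ℝ := fun z => if realDensity ν ref z ≤ realDensity μ ref z then 1 else -1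
    with hsgn
  have hmeas : Measurable sgn := Measurable.ite
    (measurableSet_le measurable_realDensity measurable_realDensity) measurable_const
    measurable_const
  have hle : ∀ z, |sgn z| ≤ 1 := fun z => by
    simp only [hsgn]
    split_ifs <;> simp
  have hint : ∀ (μ : Measure X) [IsFiniteMeasure μ],
      Integrable (fun z => realDensity μ ref z * sgn z) ref := fun μ _ =>
    integrable_realDensity.mul_bdd hmeas.aestronglyMeasurable (ae_of_all _ hle)
  have habs : ∀ z, |realDensity μ ref z - realDensity ν ref z| =
      realDensity μ ref z * sgn z - realDensity ν ref z * sgn z := fun z => by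
    simp only [hsgn]
    split_ifs with hz
    · rw [abs_of_nonneg (sub_nonneg.2 hz), mul_one, mul_one]
    · rw [abs_of_neg (sub_neg.2 (not_le.1 hz))]
      ring
  simp_rw [habs]
  rw [integral_sub (hint μ) (hint ν)]
  simp_rw [realDensity]
  rw [integral_toReal_rnDeriv_mul hμ, integral_toReal_rnDeriv_mul hν]
  exact (le_abs_self _).trans (h sgn hmeas hle)

theorem exists_tendsto_integral_mul_of_geometric {p : ℕ → X → ℝ} {B γ : ℝ}
    (hp : ∀ n, Integrable (p n) ref) (hγ : γ < 1)
    (h : ∀ n, ∫ z, |p (n + 1) z - p n z| ∂ref ≤ B * γ ^ n) :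
    ∃ q : X → ℝ, Integrable q ref ∧ ∀ ψ : X → ℝ, Measurable ψ → (∀ z, |ψ z| ≤ 1) →
      Tendsto (fun n => ∫ z, p n z * ψ z ∂ref) atTop (𝓝 (∫ z, q z * ψ z ∂ref)) := by
  have hcauchy : CauchySeq fun n => (hp n).toL1 (p n) := by
    refine cauchySeq_of_le_geometric γ B hγ fun n => ?_
    rw [dist_comm, dist_eq_norm, ← Integrable.toL1_sub, L1.norm_of_fun_eq_integral_norm]
    exact h n
  obtain ⟨q, hq⟩ := cauchySeq_tendsto_of_complete hcauchy
  refine ⟨q, L1.integrable_coeFn q, fun ψ hψ hψ1 => ?_⟩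
  have hdist : ∀ n, |∫ z, p n z * ψ z ∂ref - ∫ z, q z * ψ z ∂ref| ≤
      dist ((hp n).toL1 (p n)) q := fun n => by
    rw [← integral_sub ((hp n).mul_bdd hψ.aestronglyMeasurable (ae_of_all _ hψ1))
      ((L1.integrable_coeFn q).mul_bdd hψ.aestronglyMeasurable (ae_of_all _ hψ1)),
      L1.dist_eq_integral_dist]
    simp_rw [dist_eq_norm, ← Real.norm_eq_abs]
    refine norm_integral_le_of_norm_le
      ((L1.integrable_coeFn ((hp n).toL1 (p n))).sub (L1.integrable_coeFn q)).norm ?_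
    filter_upwards [(hp n).coeFn_toL1] with z hz
    rw [hz, ← sub_mul, norm_mul]
    exact mul_le_of_le_one_right (norm_nonneg _) (hψ1 z)
  exact tendsto_iff_dist_tendsto_zero.2
    (squeeze_zero (fun _ => dist_nonneg) hdist (tendsto_iff_dist_tendsto_zero.1 hq))

theorem exists_density_of_forall_tendsto {a : ℕ → Measure X} [∀ n, IsProbabilityMeasure (a n)]
    {q : X → ℝ} (hq : Integrable q ref)
    (hlim : ∀ ψ : X → ℝ, Measurable ψ → (∀ z, |ψ z| ≤ 1) →
      Tendsto (fun n => ∫ z, ψ z ∂(a n)) atTop (𝓝 (∫ z, q z * ψ z ∂ref))) :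
    ∃ p : X → ℝ≥0, Measurable p ∧
      IsProbabilityMeasure (ref.withDensity fun z => (p z : ℝ≥0∞)) ∧
      ∀ ψ : X → ℝ, Measurable ψ → (∀ z, |ψ z| ≤ 1) →
        Tendsto (fun n => ∫ z, ψ z ∂(a n)) atTop
          (𝓝 (∫ z, ψ z ∂(ref.withDensity fun z => (p z : ℝ≥0∞)))) := by
  have hq0 : 0 ≤ᵐ[ref] q := by
    refine ae_nonneg_of_forall_setIntegral_nonneg hq fun A hA _ => ?_
    have hA' : ∫ z, q z * A.indicator 1 z ∂ref = ∫ z in A, q z ∂ref := by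
      simp_rw [← integral_indicator hA, ← indicator_mul_right, Pi.one_apply, mul_one]
    rw [← hA']
    exact ge_of_tendsto' (hlim _ (measurable_one.indicator hA) (abs_indicator_one_le A))
      fun n => integral_nonneg (indicator_nonneg fun z _ => zero_le_one)
  obtain ⟨p, hp, hpq⟩ : ∃ p : X → ℝ≥0, Measurable p ∧ ∀ᵐ z ∂ref, (p z : ℝ) = q z := by
    refine ⟨fun z => (hq.aestronglyMeasurable.mk q z).toNNReal,
      hq.aestronglyMeasurable.stronglyMeasurable_mk.measurable.real_toNNReal, ?_⟩
    filter_upwards [hq0, hq.aestronglyMeasurable.ae_eq_mk] with z hz hmk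
    rw [← hmk, Real.coe_toNNReal _ hz]
  have hint : ∀ ψ : X → ℝ,
      ∫ z, ψ z ∂(ref.withDensity fun z => (p z : ℝ≥0∞)) = ∫ z, q z * ψ z ∂ref := fun ψ => by
    rw [integral_withDensity_eq_integral_smul hp]
    exact integral_congr_ae (hpq.mono fun z hz => by simp only [NNReal.smul_def, hz, smul_eq_mul])
  simp_rw [← hint] at hlim
  refine ⟨p, hp, ⟨?_⟩, hlim⟩
  have hmass := hlim (fun _ => 1) measurable_const (by simp)
  simp_rw [integral_const, smul_eq_mul, mul_one, probReal_univ] at hmass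
  exact (ENNReal.toReal_eq_one_iff _).1 (tendsto_nhds_unique tendsto_const_nhds hmass).symm

theorem invariant_of_tendsto [IsMarkovKernel P] {π : Measure X} [IsProbabilityMeasure π] {x : X}
    (h : ∀ ψ : X → ℝ, Measurable ψ → (∀ z, |ψ z| ≤ 1) →
      Tendsto (fun n => ∫ z, ψ z ∂((P ^ (n + 1)) x)) atTop (𝓝 (∫ z, ψ z ∂π))) :
    P.Invariant π := by
  refine measure_eq_of_integral_indicator fun A hA => ?_
  have hmeas : Measurable (A.indicator (1 : X → ℝ)) := measurable_one.indicator hA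
  have hint : ∀ (μ : Measure X) [IsProbabilityMeasure μ],
      Integrable (A.indicator (1 : X → ℝ)) μ := fun μ _ =>
    integrable_of_abs_le (integrable_const 1) hmeas (abs_indicator_one_le A)
  rw [integral_bind_kernel (hint _)]
  have hstep := h (fun y => ∫ z, A.indicator 1 z ∂(P y)) (measurable_integral_kernel P hmeas)
    fun y => (abs_integral_le_of_abs_le (integrable_const 1) (abs_indicator_one_le A)).trans_eq
      (by simp)
  refine tendsto_nhds_unique hstep
    (((tendsto_add_atTop_iff_nat 1).2 (h _ hmeas (abs_indicator_one_le A))).congr fun n => ?_)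
  rw [add_comm (n + 1) 1, integral_pow_add P 1 (n + 1) (hint _), pow_one]

theorem pow_succ_absolutelyContinuous (hac : ∀ x, P x ≪ ref) (n : ℕ) (x : X) :
    (P ^ (n + 1)) x ≪ ref := by
  refine Measure.AbsolutelyContinuous.mk fun s hs hs0 => ?_
  rw [Kernel.pow_succ_apply_eq_lintegral _ _ _ hs]
  simp only [hac _ hs0, lintegral_zero]

theorem GeometricOscillation.exists_invariant_density [SigmaFinite ref] [IsMarkovKernel P]
    {V : X → ℝ} {R γ : ℝ} (hosc : GeometricOscillation P V R γ) (hγ : γ < 1)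
    (hV1 : ∀ x, 1 ≤ V x) {x : X}
    (hVx : Integrable V (P x)) (hac : ∀ x, P x ≪ ref) :
    ∃ p : X → ℝ≥0, Measurable p ∧
      IsProbabilityMeasure (ref.withDensity fun z => (p z : ℝ≥0∞)) ∧
      P.Invariant (ref.withDensity fun z => (p z : ℝ≥0∞)) := by
  have hac' := fun n => pow_succ_absolutelyContinuous hac n x
  obtain ⟨q, hq, hlim⟩ := exists_tendsto_integral_mul_of_geometric (ref := ref) (γ := γ)
    (p := fun n => realDensity ((P ^ (n + 1)) x) ref) (B := R * γ * (V x + ∫ z, V z ∂(P x)))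
    (fun n => integrable_realDensity) hγ fun n =>
      integral_abs_realDensity_sub_le (hac' (n + 1)) (hac' n) fun ψ hψ hψ1 =>
        (hosc.abs_integral_pow_succ_sub_le hVx hψ hψ1 hV1 (n + 1)).trans_eq (by ring)
  simp_rw [realDensity, integral_toReal_rnDeriv_mul (hac' _)] at hlim
  obtain ⟨p, hp, hprob, hlim⟩ := exists_density_of_forall_tendsto hq hlim
  exact ⟨p, hp, hprob, invariant_of_tendsto hlim⟩

end Density

end Invariant

/-! ### Bias and variance of ergodic averages -/

section Chain

variable {X Ω : Type*} [MeasurableSpace X] [MeasurableSpace Ω]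

/-- `Z` is, under `P`, a Markov chain with transition kernel `K` started at `x₀`. The transition
law is given conditionally on the whole past `Z₀, …, Z_k`. -/
structure IsMarkovChain (P : Measure Ω) (K : Kernel X X) (x₀ : X) (Z : ℕ → Ω → X) : Prop where
  measurable : ∀ k, Measurable (Z k)
  init : ∀ᵐ ω ∂P, Z 0 ω = x₀
  transition : ∀ k, HasCondDistrib (Z (k + 1)) (fun ω (i : Finset.Iic k) => Z i ω)
    (K.comap (fun h : Finset.Iic k → X => h ⟨k, by simp⟩) (measurable_pi_apply _)) P

/-- Geometric ergodicity of `K` in the `V`-weighted norm, with limit law `π`. -/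
structure IsGeometricallyErgodic (K : Kernel X X) (π : Measure X) (V : X → ℝ) (R γ : ℝ) :
    Prop where
  measurable : Measurable V
  one_le : ∀ x, 1 ≤ V x
  const_nonneg : 0 ≤ R
  rate_nonneg : 0 ≤ γ
  rate_lt_one : γ < 1
  integrable_pow : ∀ (k : ℕ) (x : X), Integrable V ((K ^ k) x)
  abs_integral_pow_sub_le : ∀ (k : ℕ) (x : X) (ψ : X → ℝ), Measurable ψ → (∀ z, |ψ z| ≤ V z) →
    |∫ z, ψ z ∂((K ^ k) x) - ∫ z, ψ z ∂π| ≤ R * V x * γ ^ k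

theorem integrable_of_bdd {μ : Measure X} [IsFiniteMeasure μ] {ψ : X → ℝ} {S : ℝ}
    (hψ : Measurable ψ) (h : ∀ z, |ψ z| ≤ S) : Integrable ψ μ :=
  integrable_of_abs_le (integrable_const S) hψ h

theorem abs_integral_le_of_bdd {μ : Measure X} [IsProbabilityMeasure μ] {ψ : X → ℝ} {S : ℝ}
    (h : ∀ z, |ψ z| ≤ S) : |∫ z, ψ z ∂μ| ≤ S :=
  (abs_integral_le_of_abs_le (integrable_const S) h).trans_eq (by simp)

theorem abs_mul_le_mul {u v S T : ℝ} (hu : |u| ≤ S) (hv : |v| ≤ T) : |u * v| ≤ S * T := by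
  rw [abs_mul]
  exact mul_le_mul hu hv (abs_nonneg v) ((abs_nonneg u).trans hu)

theorem sum_geometric_Icc_le {γ : ℝ} (hγ0 : 0 ≤ γ) (hγ : γ < 1) (n : ℕ) :
    ∑ k ∈ Finset.Icc 1 n, γ ^ k ≤ 1 / (1 - γ) := by
  rw [one_div, ← tsum_geometric_of_lt_one hγ0 hγ]
  exact (summable_geometric_of_lt_one hγ0 hγ).sum_le_tsum _ fun k _ => pow_nonneg hγ0 k

theorem sum_mul_geometric_Icc_le {γ : ℝ} (hγ0 : 0 ≤ γ) (hγ : γ < 1) (n : ℕ) :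
    ∑ k ∈ Finset.Icc 1 n, (k : ℝ) * γ ^ k ≤ ∑' k : ℕ, (k : ℝ) * γ ^ k := by
  have hsum := summable_pow_mul_geometric_of_norm_lt_one 1
    (show ‖γ‖ < 1 by rwa [Real.norm_eq_abs, abs_of_nonneg hγ0])
  simp only [pow_one] at hsum
  exact hsum.sum_le_tsum _ fun k _ => by positivity

theorem sum_Icc_reflect {A : Type*} [AddCommMonoid A] (u : ℕ → A) (n : ℕ) :
    ∑ k ∈ Finset.Icc 1 n, u (n + 1 - k) = ∑ k ∈ Finset.Icc 1 n, u k :=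
  Finset.sum_nbij' (fun k => n + 1 - k) (fun k => n + 1 - k)
    (by simp only [Finset.mem_Icc]; omega) (by simp only [Finset.mem_Icc]; omega)
    (by simp only [Finset.mem_Icc]; omega) (by simp only [Finset.mem_Icc]; omega)
    fun _ _ => rfl

section Ergodic

variable {K : Kernel X X} {π : Measure X} {V : X → ℝ} {R γ : ℝ}

theorem IsGeometricallyErgodic.nonneg (h : IsGeometricallyErgodic K π V R γ) (x : X) : 0 ≤ V x :=
  zero_le_one.trans (h.one_le x)

theorem IsGeometricallyErgodic.abs_le_mul {u : X → ℝ} {S : ℝ}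
    (h : IsGeometricallyErgodic K π V R γ) (hu : ∀ z, |u z| ≤ S) (z : X) : |u z| ≤ S * V z :=
  (hu z).trans (le_mul_of_one_le_right ((abs_nonneg _).trans (hu z)) (h.one_le z))

theorem IsGeometricallyErgodic.abs_integral_pow_sub_le_mul
    (h : IsGeometricallyErgodic K π V R γ) {ψ : X → ℝ} {S : ℝ} (hψ : Measurable ψ)
    (hψS : ∀ z, |ψ z| ≤ S * V z) (k : ℕ) (x : X) :
    |∫ z, ψ z ∂((K ^ k) x) - ∫ z, ψ z ∂π| ≤ S * (R * V x * γ ^ k) := by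
  have hS : 0 ≤ S := nonneg_of_mul_nonneg_left ((abs_nonneg _).trans (hψS x))
    (zero_lt_one.trans_le (h.one_le x))
  rcases hS.eq_or_lt with rfl | hS
  · have hψ0 : ∀ z, ψ z = 0 := fun z => by simpa using hψS z
    simp [hψ0]
  · have hscaled := h.abs_integral_pow_sub_le k x (fun z => S⁻¹ * ψ z) (hψ.const_mul _) fun z => by
      rw [abs_mul, abs_of_pos (inv_pos.2 hS), inv_mul_le_iff₀ hS]
      exact hψS z
    rwa [integral_const_mul, integral_const_mul, ← mul_sub, abs_mul, abs_of_pos (inv_pos.2 hS),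
      inv_mul_le_iff₀ hS] at hscaled

theorem IsGeometricallyErgodic.mul_integral_pow_sub_le (h : IsGeometricallyErgodic K π V R γ)
    {s : X → ℝ} {S c B : ℝ} (hs : Measurable s) (hsS : ∀ z, |s z| ≤ S)
    (hc : |c - ∫ z, s z ∂π| ≤ B) (i : ℕ) (x : X) :
    s x * (∫ z, s z ∂((K ^ i) x) - c) ≤ S * R * γ ^ i * (|s x| * V x) + S * B := by
  have hdev : |∫ z, s z ∂((K ^ i) x) - c| ≤ S * (R * V x * γ ^ i) + B :=
    (abs_sub_le _ (∫ z, s z ∂π) _).trans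
      (add_le_add (h.abs_integral_pow_sub_le_mul hs (h.abs_le_mul hsS) i x)
        ((abs_sub_comm _ _).trans_le hc))
  calc s x * (∫ z, s z ∂((K ^ i) x) - c)
      ≤ |s x| * |∫ z, s z ∂((K ^ i) x) - c| := (le_abs_self _).trans_eq (abs_mul _ _)
    _ ≤ |s x| * (S * (R * V x * γ ^ i) + B) := by gcongr
    _ = S * R * γ ^ i * (|s x| * V x) + |s x| * B := by ring
    _ ≤ S * R * γ ^ i * (|s x| * V x) + S * B :=
        add_le_add le_rfl
          (mul_le_mul_of_nonneg_right (hsS x) ((abs_nonneg _).trans hc))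

end Ergodic

variable {P : Measure Ω} [IsProbabilityMeasure P] {K : Kernel X X} {x₀ : X} {Z : ℕ → Ω → X}

theorem IsMarkovChain.memLp_comp (hZ : IsMarkovChain P K x₀ Z) {s : X → ℝ} {S : ℝ}
    (hs : Measurable s) (hsS : ∀ z, |s z| ≤ S) (k : ℕ) : MemLp (fun ω => s (Z k ω)) 2 P :=
  MemLp.of_bound (hs.comp (hZ.measurable k)).aestronglyMeasurable S (ae_of_all _ fun _ => hsS _)

variable [IsMarkovKernel K]

theorem IsMarkovChain.hasCondDistrib_pair (hZ : IsMarkovChain P K x₀ Z) {j k : ℕ} (hjk : j ≤ k) :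
    HasCondDistrib (Z (k + 1)) (fun ω => (Z j ω, Z k ω)) (K.prodMkLeft X) P :=
  HasCondDistrib.comp_right (κ := K.prodMkLeft X)
    (f := fun h : Finset.Iic k → X => (h ⟨j, by simpa using hjk⟩, h ⟨k, by simp⟩))
    (hf := by fun_prop) (hZ.transition k)

theorem IsMarkovChain.integral_mul_succ (hZ : IsMarkovChain P K x₀ Z) {u ψ : X → ℝ} {S S' : ℝ}
    (hu : Measurable u) (hψ : Measurable ψ) (huS : ∀ z, |u z| ≤ S) (hψS : ∀ z, |ψ z| ≤ S')
    {j k : ℕ} (hjk : j ≤ k) :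
    ∫ ω, u (Z j ω) * ψ (Z (k + 1) ω) ∂P = ∫ ω, u (Z j ω) * ∫ z, ψ z ∂(K (Z k ω)) ∂P := by
  have hF : Measurable fun p : (X × X) × X => u p.1.1 * ψ p.2 := by fun_prop
  have hpair : Measurable fun ω => (Z j ω, Z k ω) := (hZ.measurable j).prodMk (hZ.measurable k)
  have := Measure.isProbabilityMeasure_map hpair.aemeasurable (μ := P)
  calc ∫ ω, u (Z j ω) * ψ (Z (k + 1) ω) ∂P
      = ∫ p, u p.1.1 * ψ p.2 ∂(P.map fun ω => ((Z j ω, Z k ω), Z (k + 1) ω)) :=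
        (integral_map (hpair.prodMk (hZ.measurable _)).aemeasurable hF.aestronglyMeasurable).symm
    _ = ∫ p, u p.1.1 * ψ p.2 ∂((P.map fun ω => (Z j ω, Z k ω)) ⊗ₘ K.prodMkLeft X) := by
        rw [(hZ.hasCondDistrib_pair hjk).map_eq]
    _ = ∫ q, ∫ z, u q.1 * ψ z ∂(K q.2) ∂(P.map fun ω => (Z j ω, Z k ω)) :=
        Measure.integral_compProd (integrable_of_bdd hF fun p => abs_mul_le_mul (huS _) (hψS _))
    _ = ∫ q, u q.1 * ∫ z, ψ z ∂(K q.2) ∂(P.map fun ω => (Z j ω, Z k ω)) := by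
        simp_rw [integral_const_mul]
    _ = ∫ ω, u (Z j ω) * ∫ z, ψ z ∂(K (Z k ω)) ∂P := integral_map hpair.aemeasurable
        ((hu.comp measurable_fst).mul
          ((measurable_integral_kernel K hψ).comp measurable_snd)).aestronglyMeasurable

theorem IsMarkovChain.integral_mul_add (hZ : IsMarkovChain P K x₀ Z) {u : X → ℝ} {S : ℝ}
    (hu : Measurable u) (huS : ∀ z, |u z| ≤ S) (j i : ℕ) {ψ : X → ℝ} {S' : ℝ}
    (hψ : Measurable ψ) (hψS : ∀ z, |ψ z| ≤ S') :
    ∫ ω, u (Z j ω) * ψ (Z (j + i) ω) ∂P = ∫ ω, u (Z j ω) * ∫ z, ψ z ∂((K ^ i) (Z j ω)) ∂P := by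
  induction i generalizing ψ with
  | zero =>
    simp_rw [pow_zero_kernel_apply, integral_dirac' _ _ hψ.stronglyMeasurable, add_zero]
  | succ i ih =>
    rw [← add_assoc, hZ.integral_mul_succ hu hψ huS hψS (Nat.le_add_right j i),
      ih (measurable_integral_kernel K hψ) fun _ => abs_integral_le_of_bdd hψS]
    congr 1 with ω
    rw [add_comm i 1, integral_pow_add K 1 i (integrable_of_bdd hψ hψS), pow_one]

theorem IsMarkovChain.map_eq (hZ : IsMarkovChain P K x₀ Z) (k : ℕ) :
    P.map (Z k) = (K ^ k) x₀ := by
  have := Measure.isProbabilityMeasure_map (hZ.measurable k).aemeasurable (μ := P)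
  refine measure_eq_of_integral_indicator fun A hA => ?_
  have hψ : Measurable (A.indicator (1 : X → ℝ)) := measurable_one.indicator hA
  have hmarkov := hZ.integral_mul_add (u := fun _ => 1) (S := 1) measurable_const (by simp) 0 k hψ
    (abs_indicator_one_le A)
  simp only [one_mul, zero_add] at hmarkov
  have hinit : (fun ω => ∫ z, A.indicator 1 z ∂((K ^ k) (Z 0 ω))) =ᵐ[P]
      fun _ => ∫ z, A.indicator (1 : X → ℝ) z ∂((K ^ k) x₀) := by
    filter_upwards [hZ.init] with ω hω
    rw [hω]
  rw [integral_map (hZ.measurable k).aemeasurable hψ.aestronglyMeasurable, hmarkov,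
    integral_congr_ae hinit, integral_const, probReal_univ, one_smul]

theorem IsMarkovChain.integral_comp (hZ : IsMarkovChain P K x₀ Z) {u : X → ℝ}
    (hu : Measurable u) (k : ℕ) : ∫ ω, u (Z k ω) ∂P = ∫ z, u z ∂((K ^ k) x₀) := by
  rw [← hZ.map_eq k, integral_map (hZ.measurable k).aemeasurable hu.aestronglyMeasurable]

variable {π : Measure X} {V s : X → ℝ} {R γ S : ℝ}

theorem IsMarkovChain.abs_integral_comp_sub_le (hZ : IsMarkovChain P K x₀ Z)
    (h : IsGeometricallyErgodic K π V R γ) {ψ : X → ℝ} (hψ : Measurable ψ)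
    (hψS : ∀ z, |ψ z| ≤ S * V z) (k : ℕ) :
    |∫ ω, ψ (Z k ω) ∂P - ∫ z, ψ z ∂π| ≤ S * (R * V x₀ * γ ^ k) := by
  rw [hZ.integral_comp hψ]
  exact h.abs_integral_pow_sub_le_mul hψ hψS k x₀

theorem integral_mean_sub_eq {Y : ℕ → Ω → ℝ} (hY : ∀ k, Integrable (Y k) P) (σ : ℝ) {n : ℕ}
    (hn : 1 ≤ n) :
    ∫ ω, ((1 / n : ℝ) * ∑ k ∈ Finset.Icc 1 n, Y k ω - σ) ∂P =
      (1 / n : ℝ) * ∑ k ∈ Finset.Icc 1 n, (∫ ω, Y k ω ∂P - σ) := by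
  have : (0 : ℝ) < n := by exact_mod_cast hn
  rw [integral_sub ((integrable_finsetSum _ fun k _ => hY k).const_mul _) (integrable_const _),
    integral_const_mul, integral_finsetSum _ fun k _ => hY k]
  simp only [Finset.sum_sub_distrib, integral_const, probReal_univ, one_smul, Finset.sum_const,
    Nat.card_Icc, Nat.add_sub_cancel, nsmul_eq_mul]
  field_simp

theorem IsMarkovChain.bias_le (hZ : IsMarkovChain P K x₀ Z)
    (h : IsGeometricallyErgodic K π V R γ) (hs : Measurable s) (hsS : ∀ z, |s z| ≤ S) {n : ℕ}
    (hn : 1 ≤ n) :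
    |∫ ω, ((1 / n : ℝ) * ∑ k ∈ Finset.Icc 1 n, s (Z k ω) - ∫ x, s x ∂π) ∂P| ≤
      S * (R * V x₀ / (n * (1 - γ))) := by
  have hS : 0 ≤ S := (abs_nonneg _).trans (hsS x₀)
  have hcoef : 0 ≤ S * (R * V x₀) := mul_nonneg hS (mul_nonneg h.const_nonneg (h.nonneg x₀))
  rw [integral_mean_sub_eq (Y := fun k ω => s (Z k ω)) (fun k =>
    integrable_of_bdd (hs.comp (hZ.measurable k)) fun _ => hsS _) _ hn, abs_mul,
    abs_of_nonneg (by positivity : (0 : ℝ) ≤ 1 / n)]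
  calc (1 / n : ℝ) * |∑ k ∈ Finset.Icc 1 n, (∫ ω, s (Z k ω) ∂P - ∫ x, s x ∂π)|
      ≤ (1 / n : ℝ) * ∑ k ∈ Finset.Icc 1 n, S * (R * V x₀) * γ ^ k := by
        gcongr
        refine (Finset.abs_sum_le_sum_abs _ _).trans (Finset.sum_le_sum fun k _ => ?_)
        exact (hZ.abs_integral_comp_sub_le h hs (h.abs_le_mul hsS) k).trans_eq (by ring)
    _ ≤ (1 / n : ℝ) * (S * (R * V x₀) * (1 / (1 - γ))) := by
        rw [← Finset.mul_sum]
        gcongr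
        exact sum_geometric_Icc_le h.rate_nonneg h.rate_lt_one n
    _ = S * (R * V x₀ / (n * (1 - γ))) := by rw [← div_div]; ring

theorem IsMarkovChain.covariance_eq (hZ : IsMarkovChain P K x₀ Z) (hs : Measurable s)
    (hsS : ∀ z, |s z| ≤ S) (k i : ℕ) :
    cov[fun ω => s (Z k ω), fun ω => s (Z (k + i) ω); P] =
      ∫ ω, s (Z k ω) * (∫ z, s z ∂((K ^ i) (Z k ω)) - ∫ ω', s (Z (k + i) ω') ∂P) ∂P := by
  have hcond : Measurable fun y => ∫ z, s z ∂((K ^ i) y) := measurable_integral_kernel _ hs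
  rw [covariance_eq_sub (hZ.memLp_comp hs hsS k) (hZ.memLp_comp hs hsS (k + i))]
  simp_rw [mul_sub]
  rw [integral_sub, integral_mul_const, ← hZ.integral_mul_add hs hsS k i hs hsS]
  · rfl
  · exact integrable_of_bdd ((hs.mul hcond).comp (hZ.measurable k)) fun _ =>
      abs_mul_le_mul (hsS _) (abs_integral_le_of_bdd hsS)
  · exact (integrable_of_bdd (hs.comp (hZ.measurable k)) fun _ => hsS _).mul_const _

theorem IsMarkovChain.integrable_abs_mul_comp (hZ : IsMarkovChain P K x₀ Z)
    (h : IsGeometricallyErgodic K π V R γ) (hs : Measurable s) (hsS : ∀ z, |s z| ≤ S) (k : ℕ) :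
    Integrable (fun ω => |s (Z k ω)| * V (Z k ω)) P := by
  have hV := h.measurable
  have hsV : Integrable (fun z => |s z| * V z) (P.map (Z k)) := by
    rw [hZ.map_eq k]
    exact integrable_of_abs_le ((h.integrable_pow k x₀).const_mul S) (by fun_prop) fun z =>
      abs_mul_le_mul ((abs_abs _).trans_le (hsS z)) (abs_of_nonneg (h.nonneg z)).le
  exact hsV.comp_measurable (hZ.measurable k)

/-- The two error terms come from replacing the mean of `s (Z (k + i))`, resp. the law of `Z k`, by
its stationary value. -/
theorem IsMarkovChain.covariance_le (hZ : IsMarkovChain P K x₀ Z)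
    (h : IsGeometricallyErgodic K π V R γ) (hs : Measurable s) (hsS : ∀ z, |s z| ≤ S) (k i : ℕ) :
    cov[fun ω => s (Z k ω), fun ω => s (Z (k + i) ω); P] ≤
      S * R * γ ^ i * ∫ z, |s z| * V z ∂π + S ^ 2 * (R * V x₀ * (R + 1)) * γ ^ (k + i) := by
  have hR := h.const_nonneg
  have hγ := h.rate_nonneg
  have hV := h.measurable
  have hS : 0 ≤ S := (abs_nonneg _).trans (hsS x₀)
  have hsVint := hZ.integrable_abs_mul_comp h hs hsS k
  have hsV : ∫ ω, |s (Z k ω)| * V (Z k ω) ∂P ≤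
      ∫ z, |s z| * V z ∂π + S * (R * V x₀ * γ ^ k) :=
    sub_le_iff_le_add'.1 ((le_abs_self _).trans
      (hZ.abs_integral_comp_sub_le h (ψ := fun z => |s z| * V z) (by fun_prop) (fun z =>
        abs_mul_le_mul ((abs_abs _).trans_le (hsS z)) (abs_of_nonneg (h.nonneg z)).le) k))
  have hmean := hZ.abs_integral_comp_sub_le h hs (h.abs_le_mul hsS) (k + i)
  rw [hZ.covariance_eq hs hsS]
  set c := ∫ ω, s (Z (k + i) ω) ∂P
  calc ∫ ω, s (Z k ω) * (∫ z, s z ∂((K ^ i) (Z k ω)) - c) ∂P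
      ≤ ∫ ω, (S * R * γ ^ i * (|s (Z k ω)| * V (Z k ω)) +
          S * (S * (R * V x₀ * γ ^ (k + i)))) ∂P := by
        refine integral_mono ?_ ((hsVint.const_mul _).add (integrable_const _))
          fun ω => h.mul_integral_pow_sub_le hs hsS hmean i (Z k ω)
        exact integrable_of_bdd (S := S * (S + |c|))
          ((hs.mul ((measurable_integral_kernel _ hs).sub_const c)).comp (hZ.measurable k))
          fun _ => abs_mul_le_mul (hsS _)
            ((abs_sub _ _).trans (add_le_add_left (abs_integral_le_of_bdd hsS) _))
    _ = S * R * γ ^ i * ∫ ω, |s (Z k ω)| * V (Z k ω) ∂P + S * (S * (R * V x₀ * γ ^ (k + i))) := by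
        rw [integral_add (hsVint.const_mul _) (integrable_const _), integral_const_mul,
          integral_const, probReal_univ, one_smul]
    _ ≤ S * R * γ ^ i * (∫ z, |s z| * V z ∂π + S * (R * V x₀ * γ ^ k)) +
          S * (S * (R * V x₀ * γ ^ (k + i))) := by gcongr
    _ = _ := by rw [pow_add]; ring

theorem IsMarkovChain.sum_covariance_le (hZ : IsMarkovChain P K x₀ Z)
    (h : IsGeometricallyErgodic K π V R γ) (hs : Measurable s) (hsS : ∀ z, |s z| ≤ S) (n : ℕ) :
    ∑ k ∈ Finset.Icc 1 n, cov[fun ω => s (Z k ω), fun ω => s (Z (n + 1) ω); P] ≤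
      S * (R / (1 - γ)) * ∫ z, |s z| * V z ∂π +
        S ^ 2 * (R * V x₀ * (R + 1)) * ((n + 1 : ℕ) * γ ^ (n + 1)) := by
  have hS : 0 ≤ S := (abs_nonneg _).trans (hsS x₀)
  have hR := h.const_nonneg
  have hγ := h.rate_nonneg
  have hV0 := h.nonneg x₀
  have hsV0 : 0 ≤ ∫ z, |s z| * V z ∂π :=
    integral_nonneg fun z => mul_nonneg (abs_nonneg _) (h.nonneg z)
  set A := ∫ z, |s z| * V z ∂π
  set B := S ^ 2 * (R * V x₀ * (R + 1))
  have : 0 ≤ B := by positivity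
  calc ∑ k ∈ Finset.Icc 1 n, cov[fun ω => s (Z k ω), fun ω => s (Z (n + 1) ω); P]
      ≤ ∑ k ∈ Finset.Icc 1 n, (S * R * A * γ ^ (n + 1 - k) + B * γ ^ (n + 1)) := by
        refine Finset.sum_le_sum fun k hk => ?_
        have hcov := hZ.covariance_le h hs hsS k (n + 1 - k)
        rw [show k + (n + 1 - k) = n + 1 by grind] at hcov
        exact hcov.trans_eq (by ring)
    _ = S * R * A * ∑ k ∈ Finset.Icc 1 n, γ ^ k + n * (B * γ ^ (n + 1)) := by
        rw [Finset.sum_add_distrib, ← Finset.mul_sum, sum_Icc_reflect (γ ^ ·), Finset.sum_const,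
          Nat.card_Icc, Nat.add_sub_cancel, nsmul_eq_mul]
    _ ≤ S * R * A * (1 / (1 - γ)) + (n + 1 : ℕ) * (B * γ ^ (n + 1)) := by
        gcongr
        · exact sum_geometric_Icc_le hγ h.rate_lt_one n
        · exact n.le_succ
    _ = S * (R / (1 - γ)) * A + B * ((n + 1 : ℕ) * γ ^ (n + 1)) := by ring

theorem IsMarkovChain.variance_le (hZ : IsMarkovChain P K x₀ Z)
    (h : IsGeometricallyErgodic K π V R γ) (hs : Measurable s) (hsS : ∀ z, |s z| ≤ S) (k : ℕ) :
    Var[fun ω => s (Z k ω); P] ≤ ∫ z, s z ^ 2 ∂π + S ^ 2 * (R * V x₀ * γ ^ k) := by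
  have hsq : ∀ z, |s z ^ 2| ≤ S ^ 2 := fun z => by
    rw [abs_pow]
    exact pow_le_pow_left₀ (abs_nonneg _) (hsS z) 2
  calc Var[fun ω => s (Z k ω); P] ≤ ∫ ω, s (Z k ω) ^ 2 ∂P :=
        variance_le_expectation_sq (X := fun ω => s (Z k ω))
          (hs.comp (hZ.measurable k)).aestronglyMeasurable
    _ ≤ ∫ z, s z ^ 2 ∂π + S ^ 2 * (R * V x₀ * γ ^ k) :=
        sub_le_iff_le_add'.1 ((le_abs_self _).trans
          (hZ.abs_integral_comp_sub_le h (hs.pow_const 2) (h.abs_le_mul hsq) k))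

theorem IsMarkovChain.variance_sum_le (hZ : IsMarkovChain P K x₀ Z)
    (h : IsGeometricallyErgodic K π V R γ) (hs : Measurable s) (hsS : ∀ z, |s z| ≤ S) (n : ℕ) :
    Var[fun ω => ∑ k ∈ Finset.Icc 1 n, s (Z k ω); P] ≤
      n * ∫ z, s z ^ 2 ∂π + n * S * (2 * R / (1 - γ)) * ∫ z, |s z| * V z ∂π +
        S ^ 2 * (R * V x₀ * ∑ k ∈ Finset.Icc 1 n, γ ^ k +
          2 * (R * V x₀ * (R + 1)) * ∑ k ∈ Finset.Icc 1 n, k * γ ^ k) := by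
  have hmem := hZ.memLp_comp hs hsS
  induction n with
  | zero =>
    simp only [Finset.Icc_eq_empty_of_lt zero_lt_one, Finset.sum_empty]
    exact (variance_zero P).le.trans_eq (by simp)
  | succ n ih =>
    have hsplit : (fun ω => ∑ k ∈ Finset.Icc 1 (n + 1), s (Z k ω)) =
        fun ω => (∑ k ∈ Finset.Icc 1 n, s (Z k ω)) + s (Z (n + 1) ω) :=
      funext fun ω => Finset.sum_Icc_succ_top (by omega) _
    rw [hsplit, variance_fun_add (memLp_finsetSum _ fun k _ => hmem k) (hmem _),
      covariance_fun_sum_left' (fun k _ => hmem k) (hmem _), Finset.sum_Icc_succ_top (by omega),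
      Finset.sum_Icc_succ_top (by omega)]
    refine (add_le_add (add_le_add ih (mul_le_mul_of_nonneg_left
      (hZ.sum_covariance_le h hs hsS n) zero_le_two)) (hZ.variance_le h hs hsS (n + 1))).trans_eq ?_
    push_cast
    ring

theorem IsMarkovChain.variance_mean_le (hZ : IsMarkovChain P K x₀ Z)
    (h : IsGeometricallyErgodic K π V R γ) (hs : Measurable s) (hsS : ∀ z, |s z| ≤ S) {n : ℕ}
    (hn : 1 ≤ n) :
    Var[fun ω => (1 / n : ℝ) * ∑ k ∈ Finset.Icc 1 n, s (Z k ω); P] ≤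
      1 / n * ∫ z, s z ^ 2 ∂π + S / n * (2 * R / (1 - γ) * ∫ z, |s z| * V z ∂π) +
        (R * V x₀ * (1 / (1 - γ)) + 2 * (R * V x₀ * (R + 1)) * ∑' k : ℕ, (k : ℝ) * γ ^ k) *
          S ^ 2 / n ^ 2 := by
  have : (0 : ℝ) < n := by exact_mod_cast hn
  have hR := h.const_nonneg
  have hV0 := h.nonneg x₀
  have hsum : R * V x₀ * ∑ k ∈ Finset.Icc 1 n, γ ^ k +
      2 * (R * V x₀ * (R + 1)) * ∑ k ∈ Finset.Icc 1 n, k * γ ^ k ≤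
      R * V x₀ * (1 / (1 - γ)) + 2 * (R * V x₀ * (R + 1)) * ∑' k : ℕ, (k : ℝ) * γ ^ k := by
    gcongr
    · exact sum_geometric_Icc_le h.rate_nonneg h.rate_lt_one n
    · exact sum_mul_geometric_Icc_le h.rate_nonneg h.rate_lt_one n
  have hvar := (hZ.variance_sum_le h hs hsS n).trans
    (add_le_add_right (mul_le_mul_of_nonneg_left hsum (sq_nonneg S)) _)
  rw [variance_const_mul]
  refine (mul_le_mul_of_nonneg_left hvar (sq_nonneg _)).trans_eq ?_
  field_simp

end Chain

/-! ### The hazard along a path, in the coordinate of the post-jump location -/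

section Path

open Filter Topology

variable {φ : ℝ≥0 → ℝ≥0 → ℝ≥0} {f : ℝ≥0 ≃o ℝ≥0} {κ : ℝ} {m M : ℝ≥0 → ℝ}

theorem IsFlow.continuous_uncurry (h : IsFlow φ) : Continuous (Function.uncurry φ) := by
  have hcoe : Continuous fun p : ℝ≥0 × ℝ≥0 => ((p.1 : ℝ), (p.2 : ℝ)) := by fun_prop
  rw [NNReal.isEmbedding_coe.continuous_iff]
  exact (h.contDiff.continuousOn.comp_continuous hcoe fun p => ⟨p.1.2, p.2.2⟩).congr fun p => by
    simp [Function.uncurry]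

/-- The post-jump location `f (φ x t)`, as a function of the jump time `t`. -/
def jumpLocation (φ : ℝ≥0 → ℝ≥0 → ℝ≥0) (f : ℝ≥0 ≃o ℝ≥0) (x t : ℝ≥0) : ℝ≥0 := f (φ x t)

/-- The jump time from `x` that leads to the post-jump location `u`; a junk value if `u < f x`. It
is real-valued because it is differentiated. -/
noncomputable def jumpTime (φ : ℝ≥0 → ℝ≥0 → ℝ≥0) (f : ℝ≥0 ≃o ℝ≥0) (x : ℝ≥0) (u : ℝ) : ℝ :=
  ((Function.invFun (fun t : ℝ≥0 => f (φ x t)) u.toNNReal : ℝ≥0) : ℝ)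

/-- The cumulated jump rate `cumRate` extended to real times, which are differentiated. -/
noncomputable def hazard (φ : ℝ≥0 → ℝ≥0 → ℝ≥0) (rate : ℝ≥0 → ℝ≥0) (x : ℝ≥0) (t : ℝ) : ℝ :=
  ∫ s in (0 : ℝ)..t, (rate (φ x s.toNNReal) : ℝ)

/-- The cumulated jump rate from `x` until the jump that leads to the post-jump location `u`. -/
noncomputable def hazardAt (φ : ℝ≥0 → ℝ≥0 → ℝ≥0) (f : ℝ≥0 ≃o ℝ≥0) (rate : ℝ≥0 → ℝ≥0) (x : ℝ≥0)
    (u : ℝ) : ℝ :=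
  hazard φ rate x (jumpTime φ f x u)

theorem IsFlow.continuous_path (h : IsFlow φ) (x : ℝ≥0) : Continuous (φ x) :=
  h.continuous_uncurry.comp (Continuous.prodMk_right x)

theorem IsFlow.strictMono_jumpLocation (h : IsFlow φ) (f : ℝ≥0 ≃o ℝ≥0) (x : ℝ≥0) :
    StrictMono (jumpLocation φ f x) :=
  f.strictMono.comp (h.strictMono x)

theorem IsFlow.jumpLocation_zero (h : IsFlow φ) (f : ℝ≥0 ≃o ℝ≥0) (x : ℝ≥0) :
    jumpLocation φ f x 0 = f x := by
  rw [jumpLocation, h.zero]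

theorem IsFlow.range_jumpLocation (h : IsFlow φ) (f : ℝ≥0 ≃o ℝ≥0) (x : ℝ≥0) :
    range (jumpLocation φ f x) = Ici (f x) := by
  rw [show jumpLocation φ f x = f ∘ φ x from rfl, range_comp, h.range_eq, OrderIso.image_Ici]

theorem IsFlow.jumpTime_jumpLocation (h : IsFlow φ) (f : ℝ≥0 ≃o ℝ≥0) (x t : ℝ≥0) :
    jumpTime φ f x (jumpLocation φ f x t) = t := by
  rw [jumpTime, Real.toNNReal_coe]
  exact congrArg _ (Function.leftInverse_invFun (h.strictMono_jumpLocation f x).injective t)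

theorem IsFlow.jumpLocation_jumpTime (h : IsFlow φ) (f : ℝ≥0 ≃o ℝ≥0) (x : ℝ≥0) {u : ℝ}
    (hu : (f x : ℝ) ≤ u) : jumpLocation φ f x (jumpTime φ f x u).toNNReal = u.toNNReal := by
  have hmem : u.toNNReal ∈ range (jumpLocation φ f x) := by
    rw [h.range_jumpLocation]
    exact NNReal.le_toNNReal_of_coe_le hu
  rw [jumpTime, Real.toNNReal_coe]
  exact Function.invFun_eq hmem

theorem jumpTime_nonneg (φ : ℝ≥0 → ℝ≥0 → ℝ≥0) (f : ℝ≥0 ≃o ℝ≥0) (x : ℝ≥0) (u : ℝ) :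
    0 ≤ jumpTime φ f x u := NNReal.coe_nonneg _

theorem IsFlow.path_jumpTime (h : IsFlow φ) (f : ℝ≥0 ≃o ℝ≥0) (x : ℝ≥0) {u : ℝ}
    (hu : (f x : ℝ) ≤ u) : φ x (jumpTime φ f x u).toNNReal = f.symm u.toNNReal := by
  rw [← h.jumpLocation_jumpTime f x hu, jumpLocation, OrderIso.symm_apply_apply]

theorem IsFlow.jumpTime_map (h : IsFlow φ) (f : ℝ≥0 ≃o ℝ≥0) (x : ℝ≥0) :
    jumpTime φ f x (f x) = 0 := by
  rw [← h.jumpLocation_zero f x, h.jumpTime_jumpLocation, NNReal.coe_zero]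

theorem IsFlow.strictMonoOn_jumpTime (h : IsFlow φ) (f : ℝ≥0 ≃o ℝ≥0) (x : ℝ≥0) :
    StrictMonoOn (jumpTime φ f x) (Ici (f x : ℝ)) := by
  intro u hu v hv huv
  have hlt : u.toNNReal < v.toNNReal :=
    (Real.toNNReal_lt_toNNReal_iff ((f x).2.trans_lt (lt_of_le_of_lt hu huv))).2 huv
  rw [← h.jumpLocation_jumpTime f x hu, ← h.jumpLocation_jumpTime f x hv,
    (h.strictMono_jumpLocation f x).lt_iff_lt] at hlt
  exact (Real.toNNReal_lt_toNNReal_iff_of_nonneg (jumpTime_nonneg φ f x u)).1 hlt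

theorem IsFlow.image_jumpTime_Ici (h : IsFlow φ) (f : ℝ≥0 ≃o ℝ≥0) (x : ℝ≥0) :
    jumpTime φ f x '' Ici (f x : ℝ) = Ici 0 := by
  refine Subset.antisymm (image_subset_iff.2 fun u _ => jumpTime_nonneg φ f x u) fun t ht => ?_
  refine ⟨jumpLocation φ f x t.toNNReal, ?_, ?_⟩
  · have hmem : jumpLocation φ f x t.toNNReal ∈ Ici (f x) := by
      rw [← h.range_jumpLocation]
      exact mem_range_self _
    exact_mod_cast hmem
  · rw [h.jumpTime_jumpLocation, Real.coe_toNNReal _ ht]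

theorem IsFlow.image_jumpTime_Ioi (h : IsFlow φ) (f : ℝ≥0 ≃o ℝ≥0) (x : ℝ≥0) :
    jumpTime φ f x '' Ioi (f x : ℝ) = Ioi 0 := by
  rw [← Ici_sdiff_left, (h.strictMonoOn_jumpTime f x).injOn.image_sdiff, h.image_jumpTime_Ici]
  rw [inter_eq_right.2 (singleton_subset_iff.2 self_mem_Ici), image_singleton, h.jumpTime_map,
    Ici_sdiff_left]

theorem IsFlow.continuousOn_jumpTime (h : IsFlow φ) (f : ℝ≥0 ≃o ℝ≥0) (x : ℝ≥0) :
    ContinuousOn (jumpTime φ f x) (Ici (f x : ℝ)) := by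
  intro u hu
  rcases eq_or_lt_of_le (show (f x : ℝ) ≤ u from hu) with rfl | hlt
  · refine (h.strictMonoOn_jumpTime f x).continuousWithinAt_right_of_surjOn (s := Ici (f x : ℝ))
      self_mem_nhdsWithin ?_
    intro t ht
    rw [h.jumpTime_map] at ht
    rw [h.image_jumpTime_Ici]
    exact (mem_Ioi.1 ht).le
  · refine ContinuousAt.continuousWithinAt ?_
    refine (h.strictMonoOn_jumpTime f x).continuousAt_of_image_mem_nhds (Ici_mem_nhds hlt) ?_
    rw [h.image_jumpTime_Ici]
    refine Ici_mem_nhds ?_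
    rw [← h.jumpTime_map f x]
    exact h.strictMonoOn_jumpTime f x self_mem_Ici hu hlt

theorem Assumptions.invDeriv_bounds (hyp : Assumptions φ f κ m M) (x : ℝ≥0) {u : ℝ}
    (hu : (f x : ℝ) < u) :
    m u.toNNReal ≤ invDeriv φ f x u.toNNReal ∧ invDeriv φ f x u.toNNReal ≤ M u.toNNReal :=
  hyp.invDeriv_mem x _ (Real.toNNReal_pos.2 ((f x).2.trans_lt hu))
    (NNReal.le_toNNReal_of_coe_le hu.le)

/-- Differentiability holds because `g_x ≥ m > 0`, while `derivWithin` is `0` at points where the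
derivative does not exist. -/
theorem Assumptions.hasDerivAt_jumpTime (hyp : Assumptions φ f κ m M) (x : ℝ≥0) {u : ℝ}
    (hu : (f x : ℝ) < u) :
    HasDerivAt (jumpTime φ f x) (invDeriv φ f x u.toNNReal) u := by
  have hderiv : invDeriv φ f x u.toNNReal = derivWithin (jumpTime φ f x) (Ici (f x : ℝ)) u := by
    rw [invDeriv, Real.coe_toNNReal _ ((f x).2.trans hu.le)]
    rfl
  have hne : derivWithin (jumpTime φ f x) (Ici (f x : ℝ)) u ≠ 0 := by
    rw [← hderiv]
    exact ((hyp.m_pos _).trans_le (hyp.invDeriv_bounds x hu).1).ne'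
  rw [hderiv]
  exact (differentiableWithinAt_of_derivWithin_ne_zero hne).hasDerivWithinAt.hasDerivAt
    (Ici_mem_nhds hu)

variable {rate : ℝ≥0 → ℝ≥0}

theorem IsFlow.continuous_rate_path (h : IsFlow φ) (hrate : Continuous rate) (x : ℝ≥0) :
    Continuous fun s : ℝ => (rate (φ x s.toNNReal) : ℝ) :=
  NNReal.continuous_coe.comp (hrate.comp ((h.continuous_path x).comp continuous_real_toNNReal))

theorem IsFlow.hasDerivAt_hazard (h : IsFlow φ) (hrate : Continuous rate) (x : ℝ≥0) (t : ℝ) :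
    HasDerivAt (hazard φ rate x) (rate (φ x t.toNNReal)) t :=
  intervalIntegral.integral_hasDerivAt_right
    ((h.continuous_rate_path hrate x).intervalIntegrable _ _)
    ((h.continuous_rate_path hrate x).stronglyMeasurableAtFilter _ _)
    (h.continuous_rate_path hrate x).continuousAt

theorem IsFlow.continuous_hazard (h : IsFlow φ) (hrate : Continuous rate) (x : ℝ≥0) :
    Continuous (hazard φ rate x) :=
  continuous_iff_continuousAt.2 fun t => (h.hasDerivAt_hazard hrate x t).continuousAt

theorem IsFlow.monotone_hazard (h : IsFlow φ) (hrate : Continuous rate) (x : ℝ≥0) :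
    Monotone (hazard φ rate x) :=
  monotone_of_deriv_nonneg (fun t => (h.hasDerivAt_hazard hrate x t).differentiableAt) fun t => by
    rw [(h.hasDerivAt_hazard hrate x t).deriv]
    exact NNReal.coe_nonneg _

theorem hazard_zero (φ : ℝ≥0 → ℝ≥0 → ℝ≥0) (rate : ℝ≥0 → ℝ≥0) (x : ℝ≥0) :
    hazard φ rate x 0 = 0 :=
  intervalIntegral.integral_same

theorem IsFlow.hazard_nonneg (h : IsFlow φ) (hrate : Continuous rate) (x : ℝ≥0) {t : ℝ}
    (ht : 0 ≤ t) : 0 ≤ hazard φ rate x t := by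
  rw [← hazard_zero φ rate x]
  exact h.monotone_hazard hrate x ht

theorem IsFlow.continuousOn_hazardAt (h : IsFlow φ) (f : ℝ≥0 ≃o ℝ≥0) (hrate : Continuous rate)
    (x : ℝ≥0) : ContinuousOn (hazardAt φ f rate x) (Ici (f x : ℝ)) :=
  (h.continuous_hazard hrate x).comp_continuousOn (h.continuousOn_jumpTime f x)

theorem IsFlow.hazardAt_nonneg (h : IsFlow φ) (f : ℝ≥0 ≃o ℝ≥0) (hrate : Continuous rate)
    (x : ℝ≥0) (u : ℝ) : 0 ≤ hazardAt φ f rate x u :=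
  h.hazard_nonneg hrate x (jumpTime_nonneg φ f x u)

theorem IsFlow.hazardAt_jumpLocation (h : IsFlow φ) (f : ℝ≥0 ≃o ℝ≥0) (rate : ℝ≥0 → ℝ≥0)
    (x t : ℝ≥0) : hazardAt φ f rate x (jumpLocation φ f x t) = hazard φ rate x t := by
  rw [hazardAt, h.jumpTime_jumpLocation]

theorem Assumptions.hasDerivAt_hazardAt (hyp : Assumptions φ f κ m M) (hrate : Continuous rate)
    (x : ℝ≥0) {u : ℝ} (hu : (f x : ℝ) < u) :
    HasDerivAt (hazardAt φ f rate x)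
      (rate (f.symm u.toNNReal) * invDeriv φ f x u.toNNReal) u := by
  have h := (hyp.isFlow.hasDerivAt_hazard hrate x (jumpTime φ f x u)).comp u
    (hyp.hasDerivAt_jumpTime x hu)
  rwa [hyp.isFlow.path_jumpTime f x hu.le] at h

variable {r : ℝ≥0} {L a b : ℝ}

theorem Assumptions.rate_lower_bound (hyp : Assumptions φ f κ m M) (ha : 0 < a)
    (hrate : rate ∈ rateClass f m M r L a b) {u : ℝ} (hu : (f r : ℝ) ≤ u) :
    a * u ^ b ≤ rate (f.symm u.toNNReal) * m u.toNNReal := by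
  have hu0 : 0 ≤ u := (f r).2.trans hu
  have h := hrate.2.1 (f.symm u.toNNReal) ((OrderIso.le_symm_apply f).2
    (NNReal.le_toNNReal_of_coe_le hu))
  rw [OrderIso.apply_symm_apply, Real.coe_toNNReal _ hu0,
    div_le_div_iff₀ (hyp.m_pos _) ha] at h
  linarith

theorem sub_le_sub_of_hasDerivAt_le {F G F' G' : ℝ → ℝ} {q u : ℝ} (hF : ContinuousOn F (Ici q))
    (hG : ContinuousOn G (Ici q)) (hF' : ∀ v, q < v → HasDerivAt F (F' v) v)
    (hG' : ∀ v, q < v → HasDerivAt G (G' v) v) (hle : ∀ v, q < v → F' v ≤ G' v) (hu : q ≤ u) :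
    F u - F q ≤ G u - G q := by
  have hmono : MonotoneOn (fun v => G v - F v) (Ici q) := by
    refine monotoneOn_of_hasDerivWithinAt_nonneg (f' := fun v => G' v - F' v) (convex_Ici q)
      (hG.sub hF) (fun v hv => ?_) fun v hv => ?_
    · rw [interior_Ici] at hv
      exact ((hG' v hv).sub (hF' v hv)).hasDerivWithinAt
    · rw [interior_Ici] at hv
      exact sub_nonneg.2 (hle v hv)
  linarith [hmono self_mem_Ici hu hu]

theorem hasDerivAt_const_mul_rpow {b : ℝ} (hb : 0 < b) (a v : ℝ) :
    HasDerivAt (fun v => a / (b + 1) * v ^ (b + 1)) (a * v ^ b) v := by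
  refine ((Real.hasDerivAt_rpow_const (Or.inr (by linarith))).const_mul _).congr_deriv ?_
  rw [add_sub_cancel_right]
  field_simp

theorem Assumptions.rpow_sub_le_hazardAt (hyp : Assumptions φ f κ m M) (ha : 0 < a) (hb : 0 < b)
    (hrate : rate ∈ rateClass f m M r L a b) (x : ℝ≥0) {q u : ℝ} (hqx : (f x : ℝ) ≤ q)
    (hqr : (f r : ℝ) ≤ q) (hu : q ≤ u) :
    a / (b + 1) * (u ^ (b + 1) - q ^ (b + 1)) ≤ hazardAt φ f rate x u := by
  have hincr := sub_le_sub_of_hasDerivAt_le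
    (fun v _ => (hasDerivAt_const_mul_rpow hb a v).continuousAt.continuousWithinAt)
    ((hyp.isFlow.continuousOn_hazardAt f hrate.1 x).mono (Ici_subset_Ici.2 hqx))
    (fun v _ => hasDerivAt_const_mul_rpow hb a v)
    (fun v hv => hyp.hasDerivAt_hazardAt hrate.1 x (hqx.trans_lt hv))
    (fun v hv => (hyp.rate_lower_bound ha hrate (hqr.trans hv.le)).trans
      (mul_le_mul_of_nonneg_left (hyp.invDeriv_bounds x (hqx.trans_lt hv)).1
        (NNReal.coe_nonneg _))) hu
  rw [mul_sub]
  exact hincr.trans (sub_le_self _ (hyp.isFlow.hazardAt_nonneg f hrate.1 x q))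

/-- The integrand `M(u) λ(f⁻¹(u))` in the definition of the class `ℱ(𝔠, b)`. -/
noncomputable def weightedRate (f : ℝ≥0 ≃o ℝ≥0) (M : ℝ≥0 → ℝ) (rate : ℝ≥0 → ℝ≥0) (u : ℝ) : ℝ :=
  M u.toNNReal * rate (f.symm u.toNNReal)

theorem Assumptions.continuous_weightedRate (hyp : Assumptions φ f κ m M)
    (hrate : Continuous rate) : Continuous (weightedRate f M rate) :=
  (hyp.continuous_M.comp continuous_real_toNNReal).mul (NNReal.continuous_coe.comp
    (hrate.comp (f.symm.continuous.comp continuous_real_toNNReal)))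

theorem Assumptions.weightedRate_nonneg (hyp : Assumptions φ f κ m M) (rate : ℝ≥0 → ℝ≥0) (u : ℝ) :
    0 ≤ weightedRate f M rate u :=
  mul_nonneg ((hyp.m_pos _).le.trans (hyp.m_le_M _)) (NNReal.coe_nonneg _)

theorem Assumptions.hasDerivAt_integral_weightedRate (hyp : Assumptions φ f κ m M)
    (hrate : Continuous rate) (q u : ℝ) :
    HasDerivAt (fun u => ∫ v in q..u, weightedRate f M rate v) (weightedRate f M rate u) u :=
  intervalIntegral.integral_hasDerivAt_right
    ((hyp.continuous_weightedRate hrate).intervalIntegrable _ _)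
    ((hyp.continuous_weightedRate hrate).stronglyMeasurableAtFilter _ _)
    (hyp.continuous_weightedRate hrate).continuousAt

theorem Assumptions.hazardAt_le (hyp : Assumptions φ f κ m M)
    (hrate : Continuous rate) (x : ℝ≥0) {u : ℝ} (hu : (f x : ℝ) ≤ u) :
    hazardAt φ f rate x u ≤ ∫ v in (0 : ℝ)..u, weightedRate f M rate v := by
  have hincr := sub_le_sub_of_hasDerivAt_le (hyp.isFlow.continuousOn_hazardAt f hrate x)
    (fun v _ =>
      (hyp.hasDerivAt_integral_weightedRate hrate 0 v).continuousAt.continuousWithinAt)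
    (fun v hv => hyp.hasDerivAt_hazardAt hrate x hv)
    (fun v _ => hyp.hasDerivAt_integral_weightedRate hrate 0 v)
    (fun v hv => (mul_le_mul_of_nonneg_left (hyp.invDeriv_bounds x hv).2
      (NNReal.coe_nonneg _)).trans_eq (mul_comm _ _)) hu
  have hstart : hazardAt φ f rate x (f x) = 0 := by
    rw [hazardAt, hyp.isFlow.jumpTime_map, hazard_zero]
  rw [hstart, sub_zero] at hincr
  exact hincr.trans (sub_le_self _
    (intervalIntegral.integral_nonneg (f x).2 fun v _ => hyp.weightedRate_nonneg rate v))

theorem Assumptions.tendsto_hazard (hyp : Assumptions φ f κ m M) (ha : 0 < a) (hb : 0 < b)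
    (hrate : rate ∈ rateClass f m M r L a b) (x : ℝ≥0) :
    Tendsto (hazard φ rate x) atTop atTop := by
  have hb1 : 0 < b + 1 := by linarith
  refine tendsto_atTop_atTop_of_monotone (hyp.isFlow.monotone_hazard hrate.1 x) fun B => ?_
  set q : ℝ := max (f x) (f r)
  have hlim : Tendsto (fun u : ℝ => a / (b + 1) * (u ^ (b + 1) - q ^ (b + 1))) atTop atTop :=
    ((tendsto_rpow_atTop hb1).atTop_add tendsto_const_nhds).const_mul_atTop (by positivity)
  obtain ⟨u, hBu, hqu⟩ := ((hlim.eventually_ge_atTop B).and (eventually_ge_atTop q)).exists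
  exact ⟨jumpTime φ f x u, hBu.trans
    (hyp.rpow_sub_le_hazardAt ha hb hrate x (le_max_left _ _) (le_max_right _ _) hqu)⟩

theorem Assumptions.lintegral_exp_hazard (hyp : Assumptions φ f κ m M) (ha : 0 < a) (hb : 0 < b)
    (hrate : rate ∈ rateClass f m M r L a b) (x : ℝ≥0) {c : ℝ} (hc : 0 < c) (τ : ℝ) :
    ∫⁻ t in Ioi τ, ENNReal.ofReal (rate (φ x t.toNNReal) * Real.exp (-(c * hazard φ rate x t))) =
      ENNReal.ofReal (Real.exp (-(c * hazard φ rate x τ)) / c) := by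
  have hderiv : ∀ t ∈ Ici τ, HasDerivAt (fun t => -(Real.exp (-(c * hazard φ rate x t)) / c))
      (rate (φ x t.toNNReal) * Real.exp (-(c * hazard φ rate x t))) t := fun t _ => by
    have h := (((hyp.isFlow.hasDerivAt_hazard hrate.1 x t).const_mul c).neg.exp.div_const c).neg
    refine h.congr_deriv ?_
    simp only [Pi.neg_apply]
    field_simp
  have hnonneg : ∀ t ∈ Ioi τ, 0 ≤ rate (φ x t.toNNReal) * Real.exp (-(c * hazard φ rate x t)) :=
    fun t _ => mul_nonneg (NNReal.coe_nonneg _) (Real.exp_pos _).le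
  have hlim : Tendsto (fun t => -(Real.exp (-(c * hazard φ rate x t)) / c)) atTop (𝓝 0) := by
    have hexp := Real.tendsto_exp_neg_atTop_nhds_zero.comp
      ((hyp.tendsto_hazard ha hb hrate x).const_mul_atTop hc)
    simpa using (hexp.div_const c).neg
  have hint := integrableOn_Ioi_deriv_of_nonneg' hderiv hnonneg hlim
  rw [← ofReal_integral_eq_lintegral_ofReal hint
    ((ae_restrict_iff' measurableSet_Ioi).2 (ae_of_all _ hnonneg)),
    integral_Ioi_of_hasDerivAt_of_nonneg' hderiv hnonneg hlim]
  simp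

end Path

/-! ### The kernel of the post-jump chain -/

section JumpKernel

open Filter Topology

variable {φ : ℝ≥0 → ℝ≥0 → ℝ≥0} {f : ℝ≥0 ≃o ℝ≥0} {κ : ℝ} {m M : ℝ≥0 → ℝ} {rate : ℝ≥0 → ℝ≥0}
  {r : ℝ≥0} {L a b : ℝ}

theorem lintegral_halfLine {F : ℝ≥0 → ℝ≥0∞} (hF : Measurable F) :
    ∫⁻ t, F t ∂halfLine = ∫⁻ t in Ioi (0 : ℝ), F t.toNNReal := by
  rw [halfLine, lintegral_map hF measurable_real_toNNReal, restrict_Ioi_eq_restrict_Ici]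

theorem map_coe_halfLine :
    halfLine.map ((↑) : ℝ≥0 → ℝ) = (volume : Measure ℝ).restrict (Ici 0) := by
  rw [halfLine, Measure.map_map measurable_coe_nnreal_real measurable_real_toNNReal]
  conv_rhs => rw [← Measure.map_id (μ := (volume : Measure ℝ).restrict (Ici 0))]
  exact Measure.map_congr ((ae_restrict_iff' measurableSet_Ici).2
    (ae_of_all _ fun t ht => Real.coe_toNNReal t ht))

instance : SigmaFinite halfLine := by
  have : SigmaFinite (halfLine.map ((↑) : ℝ≥0 → ℝ)) := by
    rw [map_coe_halfLine]
    infer_instance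
  exact SigmaFinite.of_map halfLine measurable_coe_nnreal_real.aemeasurable this

theorem IsFlow.measurable_jumpLocation (h : IsFlow φ) (f : ℝ≥0 ≃o ℝ≥0) (x : ℝ≥0) :
    Measurable (jumpLocation φ f x) :=
  (f.continuous.comp (h.continuous_path x)).measurable

theorem IsFlow.continuous_jumpTimeDensity (h : IsFlow φ) (hrate : Continuous rate) (x : ℝ≥0) :
    Continuous (jumpTimeDensity φ rate x) := by
  have hcum : Continuous fun t : ℝ≥0 => cumRate φ rate x t :=
    (h.continuous_hazard hrate x).comp NNReal.continuous_coe
  unfold jumpTimeDensity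
  exact (hrate.comp (h.continuous_path x)).mul (by fun_prop)

theorem IsFlow.lintegral_jumpKernel (h : IsFlow φ) (f : ℝ≥0 ≃o ℝ≥0) (hrate : Continuous rate)
    (x : ℝ≥0) {F : ℝ≥0 → ℝ≥0∞} (hF : Measurable F) :
    ∫⁻ z, F z ∂(jumpKernel φ f rate x) = ∫⁻ t in Ioi (0 : ℝ),
      ENNReal.ofReal (rate (φ x t.toNNReal) * Real.exp (-hazard φ rate x t)) *
        F (jumpLocation φ f x t.toNNReal) := by
  have hloc := h.measurable_jumpLocation f x
  have hFloc : Measurable fun t => F (jumpLocation φ f x t) := hF.comp hloc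
  have hdens : Measurable fun t : ℝ≥0 => (jumpTimeDensity φ rate x t : ℝ≥0∞) :=
    (ENNReal.continuous_coe.comp (h.continuous_jumpTimeDensity hrate x)).measurable
  rw [jumpKernel_apply f h.continuous_uncurry hrate]
  change ∫⁻ z, F z ∂(Measure.map (jumpLocation φ f x) _) = _
  rw [lintegral_map hF hloc,
    lintegral_withDensity_eq_lintegral_mul _ hdens hFloc, lintegral_halfLine (hdens.mul hFloc)]
  refine setLIntegral_congr_fun measurableSet_Ioi fun t ht => ?_
  simp only [Pi.mul_apply, jumpTimeDensity, cumRate, ENNReal.coe_mul,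
    Real.coe_toNNReal t (mem_Ioi.1 ht).le]
  rw [ENNReal.ofReal_mul (NNReal.coe_nonneg _), ENNReal.ofReal_coe_nnreal]
  rfl

theorem Assumptions.isMarkovKernel_jumpKernel (hyp : Assumptions φ f κ m M) (ha : 0 < a)
    (hb : 0 < b) (hrate : rate ∈ rateClass f m M r L a b) :
    IsMarkovKernel (jumpKernel φ f rate) := by
  refine ⟨fun x => ⟨?_⟩⟩
  have htotal := hyp.lintegral_exp_hazard ha hb hrate x one_pos 0
  simp only [one_mul, hazard_zero, neg_zero, Real.exp_zero, div_one, ENNReal.ofReal_one] at htotal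
  rw [← lintegral_one, hyp.isFlow.lintegral_jumpKernel f hrate.1 x measurable_const]
  simpa only [mul_one] using htotal

theorem IsFlow.lt_jumpLocation_iff (h : IsFlow φ) (f : ℝ≥0 ≃o ℝ≥0) {x y : ℝ≥0} (hy : f x ≤ y)
    (t : ℝ≥0) : y < jumpLocation φ f x t ↔ jumpTime φ f x y < t := by
  have hmem : f x ≤ jumpLocation φ f x t := by
    rw [← h.jumpLocation_zero f x]
    exact (h.strictMono_jumpLocation f x).monotone zero_le
  conv_rhs => rw [← h.jumpTime_jumpLocation f x t]
  rw [(h.strictMonoOn_jumpTime f x).lt_iff_lt (NNReal.coe_le_coe.2 hy) (NNReal.coe_le_coe.2 hmem),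
    NNReal.coe_lt_coe]

theorem Assumptions.jumpKernel_Ioi (hyp : Assumptions φ f κ m M) (ha : 0 < a) (hb : 0 < b)
    (hrate : rate ∈ rateClass f m M r L a b) {x y : ℝ≥0} (hy : f x ≤ y) :
    jumpKernel φ f rate x (Ioi y) = ENNReal.ofReal (Real.exp (-hazardAt φ f rate x y)) := by
  have htail := hyp.lintegral_exp_hazard ha hb hrate x one_pos (jumpTime φ f x y)
  simp only [one_mul, div_one] at htail
  rw [← lintegral_indicator_one measurableSet_Ioi, hyp.isFlow.lintegral_jumpKernel f hrate.1 x
    (measurable_one.indicator measurableSet_Ioi), hazardAt, ← htail,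
    ← inter_eq_left.2 (Ioi_subset_Ioi (jumpTime_nonneg φ f x y)),
    ← setLIntegral_indicator measurableSet_Ioi]
  refine setLIntegral_congr_fun measurableSet_Ioi fun t ht => ?_
  have hiff : jumpLocation φ f x t.toNNReal ∈ Ioi y ↔ t ∈ Ioi (jumpTime φ f x y) := by
    rw [mem_Ioi, mem_Ioi, hyp.isFlow.lt_jumpLocation_iff f hy,
      Real.coe_toNNReal t (mem_Ioi.1 ht).le]
  by_cases htime : t ∈ Ioi (jumpTime φ f x y)
  · rw [indicator_of_mem htime, indicator_of_mem (hiff.2 htime), Pi.one_apply, mul_one]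
  · rw [indicator_of_notMem htime, indicator_of_notMem (mt hiff.1 htime), mul_zero]

theorem Assumptions.map_le_mul (hyp : Assumptions φ f κ m M) (z : ℝ≥0) : (f z : ℝ) ≤ κ * z := by
  rcases eq_zero_or_pos z with rfl | hz
  · have hzero : f 0 = 0 := f.map_bot
    simp only [hzero, NNReal.coe_zero, mul_zero, le_refl]
  · exact (hyp.map_le z hz).2

theorem Assumptions.rpow_map_le (hyp : Assumptions φ f κ m M) {p : ℝ} (hp : 0 ≤ p) (z : ℝ≥0) :
    (f z : ℝ) ^ p ≤ κ ^ p * (z : ℝ) ^ p := by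
  rw [← Real.mul_rpow hyp.kappa_pos.le z.coe_nonneg]
  exact Real.rpow_le_rpow (f z).2 (hyp.map_le_mul z) hp

/-! ### Drift -/

theorem one_le_V (f : ℝ≥0 ≃o ℝ≥0) (ha : 0 < a) (hb : 0 < b) (x : ℝ≥0) : 1 ≤ V f a b x :=
  Real.one_le_exp (by positivity)

theorem measurable_V (f : ℝ≥0 ≃o ℝ≥0) (a b : ℝ) : Measurable (V f a b) := by
  have : Continuous f := f.continuous
  unfold V
  fun_prop

theorem Assumptions.rpow_jumpLocation_le (hyp : Assumptions φ f κ m M) (ha : 0 < a) (hb : 0 < b)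
    (hrate : rate ∈ rateClass f m M r L a b) (x : ℝ≥0) {q : ℝ} (hqx : (f x : ℝ) ≤ q)
    (hqr : (f r : ℝ) ≤ q) (t : ℝ≥0) :
    a / (b + 1) * (jumpLocation φ f x t : ℝ) ^ (b + 1) ≤
      a / (b + 1) * q ^ (b + 1) + hazard φ rate x t := by
  rcases le_total (jumpLocation φ f x t : ℝ) q with hle | hle
  · refine le_add_of_le_of_nonneg ?_ (hyp.isFlow.hazard_nonneg hrate.1 x t.2)
    gcongr
  · have hgrowth := hyp.rpow_sub_le_hazardAt ha hb hrate x hqx hqr hle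
    rw [hyp.isFlow.hazardAt_jumpLocation, mul_sub] at hgrowth
    linarith

theorem Assumptions.V_jumpLocation_le (hyp : Assumptions φ f κ m M) (ha : 0 < a) (hb : 0 < b)
    (hrate : rate ∈ rateClass f m M r L a b) (x : ℝ≥0) {q : ℝ} (hqx : (f x : ℝ) ≤ q)
    (hqr : (f r : ℝ) ≤ q) (t : ℝ≥0) :
    V f a b (jumpLocation φ f x t) ≤ Real.exp (κ ^ (b + 1) * (a / (b + 1) * q ^ (b + 1))) *
      Real.exp (κ ^ (b + 1) * hazard φ rate x t) := by
  rw [V, ← Real.exp_add, ← mul_add]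
  refine Real.exp_le_exp.2 ?_
  calc a / (b + 1) * (f (jumpLocation φ f x t) : ℝ) ^ (b + 1)
      ≤ a / (b + 1) * (κ ^ (b + 1) * (jumpLocation φ f x t : ℝ) ^ (b + 1)) := by
        gcongr
        exact hyp.rpow_map_le (by positivity) _
    _ = κ ^ (b + 1) * (a / (b + 1) * (jumpLocation φ f x t : ℝ) ^ (b + 1)) := by ring
    _ ≤ κ ^ (b + 1) * (a / (b + 1) * q ^ (b + 1) + hazard φ rate x t) :=
        mul_le_mul_of_nonneg_left (hyp.rpow_jumpLocation_le ha hb hrate x hqx hqr t)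
          (Real.rpow_nonneg hyp.kappa_pos.le _)

theorem Assumptions.rpow_kappa_lt_one (hyp : Assumptions φ f κ m M) {p : ℝ} (hp : 0 < p) :
    κ ^ p < 1 :=
  Real.rpow_lt_one hyp.kappa_pos.le hyp.kappa_lt_one hp

theorem Assumptions.lintegral_V_le (hyp : Assumptions φ f κ m M) (ha : 0 < a) (hb : 0 < b)
    (hrate : rate ∈ rateClass f m M r L a b) (x : ℝ≥0) {q : ℝ} (hqx : (f x : ℝ) ≤ q)
    (hqr : (f r : ℝ) ≤ q) :
    ∫⁻ z, ENNReal.ofReal (V f a b z) ∂(jumpKernel φ f rate x) ≤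
      ENNReal.ofReal (Real.exp (κ ^ (b + 1) * (a / (b + 1) * q ^ (b + 1))) /
        (1 - κ ^ (b + 1))) := by
  have hθ : 0 < 1 - κ ^ (b + 1) := sub_pos.2 (hyp.rpow_kappa_lt_one (by positivity))
  rw [hyp.isFlow.lintegral_jumpKernel f hrate.1 x (measurable_V f a b).ennreal_ofReal]
  set θ := κ ^ (b + 1)
  set B := Real.exp (θ * (a / (b + 1) * q ^ (b + 1)))
  have hpointwise : ∀ t ∈ Ioi (0 : ℝ),
      ENNReal.ofReal (rate (φ x t.toNNReal) * Real.exp (-hazard φ rate x t)) *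
        ENNReal.ofReal (V f a b (jumpLocation φ f x t.toNNReal)) ≤
      ENNReal.ofReal B * ENNReal.ofReal
        (rate (φ x t.toNNReal) * Real.exp (-((1 - θ) * hazard φ rate x t))) := by
    intro t ht
    have hV := hyp.V_jumpLocation_le ha hb hrate x hqx hqr t.toNNReal
    rw [Real.coe_toNNReal t (mem_Ioi.1 ht).le] at hV
    rw [← ENNReal.ofReal_mul (by positivity), ← ENNReal.ofReal_mul (by positivity)]
    refine ENNReal.ofReal_le_ofReal ?_
    calc _ ≤ rate (φ x t.toNNReal) * Real.exp (-hazard φ rate x t) *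
          (B * Real.exp (θ * hazard φ rate x t)) := by gcongr
      _ = B * (rate (φ x t.toNNReal) *
          (Real.exp (-hazard φ rate x t) * Real.exp (θ * hazard φ rate x t))) := by ring
      _ = _ := by
          rw [← Real.exp_add]
          ring_nf
  refine (setLIntegral_mono' measurableSet_Ioi hpointwise).trans_eq ?_
  rw [lintegral_const_mul' _ _ ENNReal.ofReal_ne_top,
    hyp.lintegral_exp_hazard ha hb hrate x hθ 0, ← ENNReal.ofReal_mul (Real.exp_pos _).le,
    hazard_zero, mul_zero, neg_zero, Real.exp_zero, mul_one_div]

theorem exists_rpow_div_le {θ : ℝ} (hθ0 : 0 ≤ θ) (hθ1 : θ < 1) :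
    ∃ C : ℝ, 0 < C ∧ ∀ v : ℝ, 0 < v → v ^ θ / (1 - θ) ≤ 1 / 2 * v + C := by
  have hpos : 0 < 1 - θ := sub_pos.2 hθ1
  set v₀ : ℝ := (2 / (1 - θ)) ^ (1 / (1 - θ)) with hv₀
  have : 0 < v₀ := Real.rpow_pos_of_pos (by positivity) _
  refine ⟨v₀ ^ θ / (1 - θ), by positivity, fun v hv => ?_⟩
  rcases le_total v v₀ with hle | hle
  · have hmono : v ^ θ / (1 - θ) ≤ v₀ ^ θ / (1 - θ) := by gcongr
    linarith
  · have hlarge : 2 / (1 - θ) ≤ v ^ (1 - θ) := by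
      calc 2 / (1 - θ) = v₀ ^ (1 - θ) := by
            rw [hv₀, ← Real.rpow_mul (by positivity), one_div, inv_mul_cancel₀ hpos.ne',
              Real.rpow_one]
        _ ≤ v ^ (1 - θ) := by gcongr
    calc v ^ θ / (1 - θ) = 1 / 2 * (v ^ θ * (2 / (1 - θ))) := by field_simp
      _ ≤ 1 / 2 * (v ^ θ * v ^ (1 - θ)) := by gcongr
      _ = 1 / 2 * v := by rw [← Real.rpow_add hv, add_sub_cancel, Real.rpow_one]
      _ ≤ 1 / 2 * v + v₀ ^ θ / (1 - θ) := le_add_of_nonneg_right (by positivity)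

theorem Assumptions.exists_geometricDrift (hyp : Assumptions φ f κ m M) (r : ℝ≥0) (ha : 0 < a)
    (hb : 0 < b) (L : ℝ) :
    ∃ C : ℝ, 0 < C ∧ ∀ rate ∈ rateClass f m M r L a b,
      GeometricDrift (jumpKernel φ f rate) (V f a b) (1 / 2) C := by
  set θ := κ ^ (b + 1)
  have hθ0 : 0 < θ := Real.rpow_pos_of_pos hyp.kappa_pos _
  have hθ1 : θ < 1 := hyp.rpow_kappa_lt_one (by positivity)
  have hV0 : ∀ y, 0 < V f a b y := fun y => Real.exp_pos _
  have hquot : ∀ y, 0 < V f a b y ^ θ / (1 - θ) := fun y =>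
    div_pos (Real.rpow_pos_of_pos (hV0 y) _) (sub_pos.2 hθ1)
  obtain ⟨C, hC, hle⟩ := exists_rpow_div_le hθ0.le hθ1
  refine ⟨C + V f a b r ^ θ / (1 - θ), add_pos hC (hquot r), fun rate hrate x => ?_⟩
  refine (hyp.lintegral_V_le ha hb hrate x (le_max_left _ (f r : ℝ))
    (le_max_right (f x : ℝ) _)).trans (ENNReal.ofReal_le_ofReal ?_)
  have hexp : ∀ y : ℝ≥0,
      Real.exp (θ * (a / (b + 1) * (f y : ℝ) ^ (b + 1))) = V f a b y ^ θ := fun y => by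
    rw [V, ← Real.exp_mul, mul_comm]
  rcases max_choice (f x : ℝ) (f r : ℝ) with hmax | hmax <;> rw [hmax, hexp]
  · linarith [hle _ (hV0 x), hquot r]
  · linarith [hV0 x]

/-! ### Minorization -/

theorem Assumptions.le_jumpKernel_Iic (hyp : Assumptions φ f κ m M) (ha : 0 < a) (hb : 0 < b)
    (hrate : rate ∈ rateClass f m M r L a b) {k : ℝ≥0} (hk : κ ≤ k) (x : ℝ≥0) :
    1 - ENNReal.ofReal (Real.exp
        (-(a / (b + 1) * (((k : ℝ) ^ (b + 1) - κ ^ (b + 1)) * (r : ℝ) ^ (b + 1))))) ≤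
      jumpKernel φ f rate x (Iic (k * max x r)) := by
  have := hyp.isMarkovKernel_jumpKernel ha hb hrate
  have hκ := hyp.kappa_pos.le
  set q : ℝ := κ * max (x : ℝ) r
  have hx : (f x : ℝ) ≤ q :=
    (hyp.map_le_mul x).trans (mul_le_mul_of_nonneg_left (le_max_left _ _) hκ)
  have hr : (f r : ℝ) ≤ q :=
    (hyp.map_le_mul r).trans (mul_le_mul_of_nonneg_left (le_max_right _ _) hκ)
  have hqy : q ≤ (k * max x r : ℝ≥0) := by
    push_cast
    exact mul_le_mul_of_nonneg_right hk (by positivity)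
  rw [← compl_Ioi, prob_compl_eq_one_sub measurableSet_Ioi,
    hyp.jumpKernel_Ioi ha hb hrate (NNReal.coe_le_coe.1 (hx.trans hqy))]
  refine tsub_le_tsub_left (ENNReal.ofReal_le_ofReal (Real.exp_le_exp.2 (neg_le_neg ?_))) 1
  refine le_trans ?_ (hyp.rpow_sub_le_hazardAt ha hb hrate x hx hr hqy)
  have hpow : 0 ≤ (k : ℝ) ^ (b + 1) - κ ^ (b + 1) :=
    sub_nonneg.2 (Real.rpow_le_rpow hκ hk (by positivity))
  push_cast
  rw [Real.mul_rpow k.coe_nonneg (by positivity), Real.mul_rpow hκ (by positivity), ← sub_mul]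
  gcongr
  exact le_max_right _ _

theorem Assumptions.exists_descent (hyp : Assumptions φ f κ m M) (hr : 0 < r) (ha : 0 < a)
    (hb : 0 < b) (L : ℝ) :
    ∃ (p : ℝ≥0∞) (k : ℝ≥0), 0 < p ∧ k < 1 ∧ ∀ rate ∈ rateClass f m M r L a b,
      ∀ x, p ≤ jumpKernel φ f rate x (Iic (k * max x r)) := by
  obtain ⟨k, hκk, hk1⟩ := exists_between hyp.kappa_lt_one
  lift k to ℝ≥0 using hyp.kappa_pos.le.trans hκk.le
  have hgap : 0 < a / (b + 1) * (((k : ℝ) ^ (b + 1) - κ ^ (b + 1)) * (r : ℝ) ^ (b + 1)) :=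
    mul_pos (by positivity) (mul_pos
      (sub_pos.2 (Real.rpow_lt_rpow hyp.kappa_pos.le hκk (by positivity)))
      (Real.rpow_pos_of_pos hr _))
  have hpos := tsub_pos_of_lt
    (ENNReal.ofReal_lt_one.2 (Real.exp_lt_one_iff.2 (neg_lt_zero.2 hgap)))
  exact ⟨_, k, hpos, hk1, fun rate hrate x => hyp.le_jumpKernel_Iic ha hb hrate hκk.le x⟩

theorem pow_le_kernel_pow_Iic {P : Kernel ℝ≥0 ℝ≥0} {p : ℝ≥0∞} {k r : ℝ≥0} (hk : k ≤ 1)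
    (h : ∀ x, p ≤ P x (Iic (k * max x r))) (n : ℕ) (x : ℝ≥0) (hx : k ^ n * x ≤ r) :
    p ^ n ≤ (P ^ n) x (Iic r) := by
  induction n generalizing x with
  | zero =>
    rw [pow_zero, one_mul] at hx
    rw [pow_zero_kernel_apply, pow_zero, Measure.dirac_apply_of_mem (mem_Iic.2 hx)]
  | succ n ih =>
    have hstep : ∀ z ∈ Iic (k * max x r), p ^ n ≤ (P ^ n) z (Iic r) := fun z hz => ih z <|
      calc k ^ n * z ≤ k ^ n * (k * max x r) := by gcongr; exact hz
        _ = max (k ^ (n + 1) * x) (k ^ (n + 1) * r) := by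
            rw [← mul_assoc, ← pow_succ, mul_max]
        _ ≤ r := max_le hx (mul_le_of_le_one_left' (pow_le_one' hk _))
    rw [add_comm n 1, Kernel.pow_add_apply_eq_lintegral P 1 n x measurableSet_Iic, pow_one]
    calc p ^ (1 + n) = p ^ n * p := by rw [add_comm, pow_succ]
      _ ≤ p ^ n * P x (Iic (k * max x r)) := by gcongr; exact h x
      _ = ∫⁻ _ in Iic (k * max x r), p ^ n ∂(P x) := by rw [setLIntegral_const]
      _ ≤ ∫⁻ z in Iic (k * max x r), (P ^ n) z (Iic r) ∂(P x) :=
          setLIntegral_mono' measurableSet_Iic hstep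
      _ ≤ _ := setLIntegral_le_lintegral _ _

theorem Assumptions.lintegral_jumpKernel_eq_lintegral_Ioi (hyp : Assumptions φ f κ m M)
    (hrate : Continuous rate) (x : ℝ≥0) {F : ℝ≥0 → ℝ≥0∞} (hF : Measurable F) :
    ∫⁻ z, F z ∂(jumpKernel φ f rate x) = ∫⁻ u in Ioi (f x : ℝ),
      ENNReal.ofReal (invDeriv φ f x u.toNNReal * (rate (f.symm u.toNNReal) *
        Real.exp (-hazardAt φ f rate x u))) * F u.toNNReal := by
  rw [hyp.isFlow.lintegral_jumpKernel f hrate x hF, ← hyp.isFlow.image_jumpTime_Ioi f x,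
    lintegral_image_eq_lintegral_abs_deriv_mul measurableSet_Ioi
      (fun u hu => (hyp.hasDerivAt_jumpTime x hu).hasDerivWithinAt)
      ((hyp.isFlow.strictMonoOn_jumpTime f x).injOn.mono Ioi_subset_Ici_self)]
  refine setLIntegral_congr_fun measurableSet_Ioi fun u hu => ?_
  have hg : 0 ≤ invDeriv φ f x u.toNNReal :=
    (hyp.m_pos _).le.trans (hyp.invDeriv_bounds x hu).1
  have hux : (f x : ℝ) ≤ u := (mem_Ioi.1 hu).le
  rw [hyp.isFlow.path_jumpTime f x hux, hyp.isFlow.jumpLocation_jumpTime f x hux,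
    abs_of_nonneg hg, ← mul_assoc, ← ENNReal.ofReal_mul hg]
  rfl

theorem Assumptions.jumpKernel_absolutelyContinuous (hyp : Assumptions φ f κ m M)
    (hrate : Continuous rate) (x : ℝ≥0) : jumpKernel φ f rate x ≪ halfLine := by
  refine Measure.AbsolutelyContinuous.mk fun A hA hnull => ?_
  have hind : Measurable (A.indicator (1 : ℝ≥0 → ℝ≥0∞)) := measurable_one.indicator hA
  have hcomp : Measurable fun u : ℝ => A.indicator (1 : ℝ≥0 → ℝ≥0∞) u.toNNReal :=
    hind.comp measurable_real_toNNReal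
  rw [← lintegral_indicator_one hA, lintegral_halfLine hind,
    lintegral_eq_zero_iff hcomp] at hnull
  rw [← lintegral_indicator_one hA, hyp.lintegral_jumpKernel_eq_lintegral_Ioi hrate x hind]
  refine lintegral_eq_zero_of_ae_eq_zero ?_
  filter_upwards [ae_restrict_of_ae_restrict_of_subset (Ioi_subset_Ioi (f x).2) hnull] with u hu
  rw [Pi.zero_apply] at hu
  rw [hu, mul_zero, Pi.zero_apply]

theorem exists_pos_mul_le_of_isCompact {X : Type*} [TopologicalSpace X] {K : Set X}
    (hK : IsCompact K) {g h : X → ℝ} (hg : ContinuousOn g K) (hh : ContinuousOn h K)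
    (hg0 : ∀ x ∈ K, 0 < g x) (hh0 : ∀ x ∈ K, 0 < h x) :
    ∃ c, 0 < c ∧ ∀ x ∈ K, c * h x ≤ g x := by
  obtain ⟨c, hc, hle⟩ := hK.exists_forall_le' (hg.div hh fun x hx => (hh0 x hx).ne')
    fun x hx => div_pos (hg0 x hx) (hh0 x hx)
  exact ⟨c, hc, fun x hx => (le_div_iff₀ (hh0 x hx)).1 (hle x hx)⟩

/-- The measure on `(q, q + 1]` with density `c W(u) exp (-(L + ∫ᵤ W))`, where `∫ᵤ` runs over
`[q, u]` and `W` is the weighted rate. For `q = f r` it minorizes the jump kernel from `[0, r]`. -/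
noncomputable def minorant (f : ℝ≥0 ≃o ℝ≥0) (M : ℝ≥0 → ℝ) (rate : ℝ≥0 → ℝ≥0) (q c L : ℝ) :
    Measure ℝ≥0 :=
  ((volume.restrict (Ioc q (q + 1))).withDensity fun u =>
    ENNReal.ofReal (c * (weightedRate f M rate u *
      Real.exp (-(L + ∫ v in q..u, weightedRate f M rate v))))).map Real.toNNReal

theorem Assumptions.continuous_integral_weightedRate (hyp : Assumptions φ f κ m M)
    (hrate : Continuous rate) (q : ℝ) :
    Continuous fun u => ∫ v in q..u, weightedRate f M rate v :=
  continuous_iff_continuousAt.2 fun u =>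
    (hyp.hasDerivAt_integral_weightedRate hrate q u).continuousAt

theorem Assumptions.continuous_minorant_density (hyp : Assumptions φ f κ m M)
    (hrate : Continuous rate) (q c L : ℝ) :
    Continuous fun u => c * (weightedRate f M rate u *
      Real.exp (-(L + ∫ v in q..u, weightedRate f M rate v))) := by
  have := hyp.continuous_weightedRate hrate
  have := hyp.continuous_integral_weightedRate hrate q
  fun_prop

theorem Assumptions.lintegral_minorant (hyp : Assumptions φ f κ m M) (hrate : Continuous rate)
    (q c L : ℝ) {F : ℝ≥0 → ℝ≥0∞} (hF : Measurable F) :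
    ∫⁻ z, F z ∂(minorant f M rate q c L) = ∫⁻ u in Ioc q (q + 1),
      ENNReal.ofReal (c * (weightedRate f M rate u *
        Real.exp (-(L + ∫ v in q..u, weightedRate f M rate v)))) * F u.toNNReal := by
  have hcomp : Measurable fun u : ℝ => F u.toNNReal := hF.comp measurable_real_toNNReal
  rw [minorant, lintegral_map hF measurable_real_toNNReal,
    lintegral_withDensity_eq_lintegral_mul _
      (hyp.continuous_minorant_density hrate q c L).measurable.ennreal_ofReal hcomp]
  rfl

theorem Assumptions.integral_minorant_density (hyp : Assumptions φ f κ m M)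
    (hrate : Continuous rate) (q c L u : ℝ) :
    ∫ v in q..u, c * (weightedRate f M rate v *
        Real.exp (-(L + ∫ w in q..v, weightedRate f M rate w))) =
      c * (Real.exp (-L) - Real.exp (-(L + ∫ v in q..u, weightedRate f M rate v))) := by
  rw [intervalIntegral.integral_eq_sub_of_hasDerivAt
    (f := fun v => -(c * Real.exp (-(L + ∫ w in q..v, weightedRate f M rate w))))
    (fun v _ => ?_) ((hyp.continuous_minorant_density hrate q c L).intervalIntegrable _ _)]
  · simp only [intervalIntegral.integral_same, add_zero]
    ring
  · refine (((((hyp.hasDerivAt_integral_weightedRate hrate q v).const_add L).neg).exp.const_mul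
      c).neg).congr_deriv ?_
    simp only [Pi.neg_apply]
    ring

theorem Assumptions.rpow_le_integral_weightedRate (hyp : Assumptions φ f κ m M) (ha : 0 < a)
    (hb : 0 ≤ b) (hrate : rate ∈ rateClass f m M r L a b) {q : ℝ} (hq : (f r : ℝ) ≤ q) :
    a * q ^ b ≤ ∫ v in q..q + 1, weightedRate f M rate v := by
  have hq0 : 0 ≤ q := (f r).2.trans hq
  have hconst : ∫ _ in q..q + 1, a * q ^ b = a * q ^ b := by
    rw [intervalIntegral.integral_const, add_sub_cancel_left, one_smul]
  rw [← hconst]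
  refine intervalIntegral.integral_mono_on (by linarith) intervalIntegrable_const
    ((hyp.continuous_weightedRate hrate.1).intervalIntegrable _ _) fun u hu => ?_
  calc a * q ^ b ≤ a * u ^ b := by gcongr; exact hu.1
    _ ≤ rate (f.symm u.toNNReal) * m u.toNNReal :=
        hyp.rate_lower_bound ha hrate (hq.trans hu.1)
    _ ≤ rate (f.symm u.toNNReal) * M u.toNNReal := by gcongr; exact hyp.m_le_M _
    _ = weightedRate f M rate u := mul_comm _ _

theorem Assumptions.le_minorant_univ (hyp : Assumptions φ f κ m M) (ha : 0 < a) (hb : 0 ≤ b)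
    (hrate : rate ∈ rateClass f m M r L a b) {q c : ℝ} (hq : (f r : ℝ) ≤ q) (hc : 0 ≤ c) :
    ENNReal.ofReal (c * (Real.exp (-L) - Real.exp (-(L + a * q ^ b)))) ≤
      minorant f M rate q c L univ := by
  rw [← lintegral_one, hyp.lintegral_minorant hrate.1 q c L measurable_const]
  simp only [mul_one]
  rw [← ofReal_integral_eq_lintegral_ofReal
    ((hyp.continuous_minorant_density hrate.1 q c L).integrableOn_Icc.mono_set
      Ioc_subset_Icc_self)
    (ae_of_all _ fun u => mul_nonneg hc
      (mul_nonneg (hyp.weightedRate_nonneg rate u) (Real.exp_pos _).le)),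
    ← intervalIntegral.integral_of_le (by linarith), hyp.integral_minorant_density hrate.1]
  gcongr
  exact hyp.rpow_le_integral_weightedRate ha hb hrate hq

theorem Assumptions.hazardAt_le_add (hyp : Assumptions φ f κ m M)
    (hrate : rate ∈ rateClass f m M r L a b) {x : ℝ≥0} (hx : x ≤ r) {u : ℝ} (hu : (f r : ℝ) ≤ u) :
    hazardAt φ f rate x u ≤ L + ∫ v in (f r : ℝ)..u, weightedRate f M rate v := by
  have hxr : (f x : ℝ) ≤ f r := NNReal.coe_le_coe.2 (f.monotone hx)
  refine (hyp.hazardAt_le hrate.1 x (hxr.trans hu)).trans ?_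
  have hint := hyp.continuous_weightedRate hrate.1
  rw [← intervalIntegral.integral_add_adjacent_intervals (b := (f r : ℝ))
    (hint.intervalIntegrable _ _) (hint.intervalIntegrable _ _)]
  exact add_le_add_left hrate.2.2 _

theorem Assumptions.minorant_le_jumpKernel (hyp : Assumptions φ f κ m M)
    (hrate : rate ∈ rateClass f m M r L a b) {c : ℝ} (hc : 0 ≤ c)
    (hcm : ∀ u ∈ Icc (f r : ℝ) (f r + 1), c * M u.toNNReal ≤ m u.toNNReal) {x : ℝ≥0}
    (hx : x ≤ r) : minorant f M rate (f r) c L ≤ jumpKernel φ f rate x := by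
  refine Measure.le_iff.2 fun A hA => ?_
  have hind : Measurable (A.indicator (1 : ℝ≥0 → ℝ≥0∞)) := measurable_one.indicator hA
  have hxr : (f x : ℝ) ≤ f r := NNReal.coe_le_coe.2 (f.monotone hx)
  rw [← lintegral_indicator_one hA, ← lintegral_indicator_one hA,
    hyp.lintegral_minorant hrate.1 _ _ _ hind,
    hyp.lintegral_jumpKernel_eq_lintegral_Ioi hrate.1 x hind]
  refine le_trans (setLIntegral_mono' measurableSet_Ioc fun u hu => ?_)
    (lintegral_mono_set (Ioc_subset_Ioi_self.trans (Ioi_subset_Ioi hxr)))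
  gcongr ENNReal.ofReal ?_ * _
  have hM : 0 ≤ M u.toNNReal := (hyp.m_pos _).le.trans (hyp.m_le_M _)
  have hcg := (hcm u (Ioc_subset_Icc_self hu)).trans
    (hyp.invDeriv_bounds x (hxr.trans_lt hu.1)).1
  have hhaz := hyp.hazardAt_le_add hrate hx hu.1.le
  calc c * (weightedRate f M rate u *
        Real.exp (-(L + ∫ v in (f r : ℝ)..u, weightedRate f M rate v)))
      = c * M u.toNNReal * (rate (f.symm u.toNNReal) *
          Real.exp (-(L + ∫ v in (f r : ℝ)..u, weightedRate f M rate v))) := by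
        rw [weightedRate]
        ring
    _ ≤ invDeriv φ f x u.toNNReal *
        (rate (f.symm u.toNNReal) * Real.exp (-hazardAt φ f rate x u)) := by
        gcongr
        exact (mul_nonneg hc hM).trans hcg

theorem Assumptions.exists_minorization (hyp : Assumptions φ f κ m M) (hr : 0 < r)
    (ha : 0 < a) (hb : 0 ≤ b) (L : ℝ) :
    ∃ ε : ℝ≥0∞, 0 < ε ∧ ∀ rate ∈ rateClass f m M r L a b, ∃ μ : Measure ℝ≥0,
      ε ≤ μ univ ∧ ∀ x ≤ r, μ ≤ jumpKernel φ f rate x := by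
  obtain ⟨c, hc, hcm⟩ := exists_pos_mul_le_of_isCompact
    (isCompact_Icc (a := (f r : ℝ)) (b := f r + 1))
    (hyp.continuous_m.comp continuous_real_toNNReal).continuousOn
    (hyp.continuous_M.comp continuous_real_toNNReal).continuousOn
    (fun _ _ => hyp.m_pos _) fun _ _ => (hyp.m_pos _).trans_le (hyp.m_le_M _)
  have hpow : 0 < a * (f r : ℝ) ^ b := mul_pos ha (Real.rpow_pos_of_pos (hyp.map_le r hr).1 b)
  refine ⟨ENNReal.ofReal (c * (Real.exp (-L) - Real.exp (-(L + a * (f r : ℝ) ^ b)))),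
    ENNReal.ofReal_pos.2 (mul_pos hc (sub_pos.2 (Real.exp_lt_exp.2 (by linarith)))),
    fun rate hrate => ⟨minorant f M rate (f r) c L, ?_, fun x hx => ?_⟩⟩
  · exact hyp.le_minorant_univ ha hb hrate le_rfl hc.le
  · exact hyp.minorant_le_jumpKernel hrate hc.le hcm hx

theorem smul_le_kernel_pow_succ {X : Type*} [MeasurableSpace X] {P : Kernel X X} {A : Set X}
    (hA : MeasurableSet A) {n : ℕ} {x : X} {p : ℝ≥0∞} (hp : p ≤ (P ^ n) x A) {μ : Measure X}
    (hμ : ∀ z ∈ A, μ ≤ P z) : p • μ ≤ (P ^ (n + 1)) x := by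
  refine Measure.le_iff.2 fun B hB => ?_
  rw [Kernel.pow_succ_apply_eq_lintegral _ _ _ hB, Measure.smul_apply, smul_eq_mul]
  calc p * μ B ≤ (P ^ n) x A * μ B := by gcongr
    _ = ∫⁻ _ in A, μ B ∂((P ^ n) x) := by rw [setLIntegral_const, mul_comm]
    _ ≤ ∫⁻ z in A, P z B ∂((P ^ n) x) := setLIntegral_mono' hA fun z hz => hμ z hz B
    _ ≤ _ := setLIntegral_le_lintegral _ _

theorem exists_bound_of_V_le (f : ℝ≥0 ≃o ℝ≥0) (ha : 0 < a) (hb : 0 < b) (d : ℝ) :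
    ∃ B : ℝ≥0, ∀ x, V f a b x ≤ d → x ≤ B := by
  have hlim : Tendsto (fun y : ℝ => Real.exp (a / (b + 1) * y ^ (b + 1))) atTop atTop :=
    Real.tendsto_exp_atTop.comp
      ((tendsto_rpow_atTop (by positivity)).const_mul_atTop (by positivity))
  obtain ⟨y, hdy, hy⟩ := ((hlim.eventually_gt_atTop d).and (eventually_ge_atTop 0)).exists
  refine ⟨f.symm y.toNNReal, fun x hx => (OrderIso.le_symm_apply f).2 ?_⟩
  by_contra! hlt
  have hyx : y < f x := (Real.toNNReal_lt_iff_lt_coe hy).1 hlt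
  have hmono : Real.exp (a / (b + 1) * y ^ (b + 1)) ≤ V f a b x := by
    rw [V]
    gcongr
  linarith

theorem exists_pow_mul_le {k : ℝ≥0} (hk : k < 1) (hr : 0 < r) (B : ℝ≥0) :
    ∃ n : ℕ, k ^ n * B ≤ r := by
  have hlim : Tendsto (fun n : ℕ => k ^ n * B) atTop (𝓝 0) := by
    simpa only [zero_mul] using (NNReal.tendsto_pow_atTop_nhds_zero_of_lt_one hk).mul_const B
  exact ((hlim.eventually (gt_mem_nhds hr)).exists).imp fun n h => h.le

theorem Assumptions.exists_minorization_pow (hyp : Assumptions φ f κ m M) (hr : 0 < r)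
    (ha : 0 < a) (hb : 0 < b) (L d : ℝ) :
    ∃ (ε : ℝ) (N : ℕ), 0 < ε ∧ ε ≤ 1 ∧ 0 < N ∧ ∀ rate ∈ rateClass f m M r L a b,
      ∃ μ : Measure ℝ≥0, ENNReal.ofReal ε ≤ μ univ ∧
        ∀ x, V f a b x ≤ d → μ ≤ (jumpKernel φ f rate ^ N) x := by
  obtain ⟨p, k, hp0, hk, hdescent⟩ := hyp.exists_descent hr ha hb L
  obtain ⟨ε, hε0, hmin⟩ := hyp.exists_minorization hr ha hb.le L
  obtain ⟨B, hB⟩ := exists_bound_of_V_le f ha hb d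
  obtain ⟨n, hn⟩ := exists_pow_mul_le hk hr B
  have hpos : 0 < p ^ n * ε := ENNReal.mul_pos (pow_ne_zero n hp0.ne') hε0.ne'
  have hfin : min 1 (p ^ n * ε) ≠ ∞ := (min_lt_of_left_lt ENNReal.one_lt_top).ne
  refine ⟨(min 1 (p ^ n * ε)).toReal, n + 1, ENNReal.toReal_pos (lt_min one_pos hpos).ne' hfin,
    ENNReal.toReal_le_of_le_ofReal zero_le_one ?_, n.succ_pos, fun rate hrate => ?_⟩
  · rw [ENNReal.ofReal_one]
    exact min_le_left _ _
  obtain ⟨μ, hμε, hμ⟩ := hmin rate hrate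
  refine ⟨p ^ n • μ, ?_, fun x hx => smul_le_kernel_pow_succ measurableSet_Iic
    (pow_le_kernel_pow_Iic hk.le (hdescent rate hrate) n x
      ((mul_le_mul_right (hB x hx) _).trans hn)) fun z hz => hμ z hz⟩
  rw [ENNReal.ofReal_toReal hfin, Measure.smul_apply, smul_eq_mul]
  exact (min_le_right _ _).trans (by gcongr)

end JumpKernel

/-! ### Ergodicity uniformly over the class of jump rates -/

section UniformErgodicity

theorem exists_uniform_geometricOscillation {X : Type*} [MeasurableSpace X] (V : X → ℝ)
    {η C ε d : ℝ} {N : ℕ} (hη : η < 1) (hC : 0 < C) (hε : 0 < ε) (hε1 : ε ≤ 1)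
    (hd : 2 * (C / (1 - η)) < (1 - η) * d) (hN : 0 < N) :
    ∃ R γ : ℝ, 0 < R ∧ 0 < γ ∧ γ < 1 ∧ ∀ (P : Kernel X X) [IsMarkovKernel P],
      IsHarris P V η C ε d N → GeometricOscillation P V R γ := by
  have hC' : 0 < C / (1 - η) := div_pos hC (sub_pos.2 hη)
  obtain ⟨β, ρ, hρ⟩ := exists_isContractionRate hη hC' hε hε1 hd
  have hβ := hρ.weight_pos
  have hρ0 := hρ.rate_pos
  have hγ0 : 0 < ρ ^ (N : ℝ)⁻¹ := Real.rpow_pos_of_pos hρ0 _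
  have hγ1 : ρ ^ (N : ℝ)⁻¹ < 1 := Real.rpow_lt_one hρ0.le hρ.rate_lt_one (by positivity)
  exact ⟨(1 + C / (1 - η)) / β / ρ * (1 + β), ρ ^ (N : ℝ)⁻¹, by positivity, hγ0, hγ1,
    fun P _ h => h.geometricOscillation hρ hγ0 hγ1.le (Real.rpow_inv_natCast_pow hρ0.le hN.ne')⟩

theorem IsHarris.isGeometricallyErgodic {X : Type*} [MeasurableSpace X] {P : Kernel X X}
    [IsMarkovKernel P] {π : Measure X} [IsProbabilityMeasure π] {V : X → ℝ}
    {η C ε d R γ : ℝ} {N : ℕ} (h : IsHarris P V η C ε d N) (hosc : GeometricOscillation P V R γ)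
    (hR : 0 ≤ R) (hγ0 : 0 ≤ γ) (hγ : γ < 1) (hπ : P.Invariant π) :
    IsGeometricallyErgodic P π V (R * (1 + C / (1 - η))) γ where
  measurable := h.measurable
  one_le := h.one_le
  const_nonneg := mul_nonneg hR (add_nonneg zero_le_one h.drift_const_nonneg)
  rate_nonneg := hγ0
  rate_lt_one := hγ
  integrable_pow := h.integrable_pow
  abs_integral_pow_sub_le k x ψ hψ hψV := by
    obtain ⟨hVπ, hVC⟩ := h.integrable_and_integral_le_of_invariant hπ
    have hVx := mul_le_mul_of_nonneg_left (h.one_le x) h.drift_const_nonneg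
    calc |∫ z, ψ z ∂((P ^ k) x) - ∫ z, ψ z ∂π|
        ≤ R * γ ^ k * (V x + ∫ z, V z ∂π) := hosc.abs_sub_invariant_le hπ hVπ hψ hψV k x
      _ ≤ R * γ ^ k * ((1 + C / (1 - η)) * V x) := by gcongr; linarith
      _ = R * (1 + C / (1 - η)) * V x * γ ^ k := by ring

theorem IsGeometricallyErgodic.mono {X : Type*} [MeasurableSpace X] {K : Kernel X X}
    {π : Measure X} {V : X → ℝ} {R R' γ : ℝ} (h : IsGeometricallyErgodic K π V R γ)
    (hR : R ≤ R') : IsGeometricallyErgodic K π V R' γ where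
  __ := h
  const_nonneg := h.const_nonneg.trans hR
  abs_integral_pow_sub_le k x ψ hψ hψV :=
    (h.abs_integral_pow_sub_le k x ψ hψ hψV).trans (mul_le_mul_of_nonneg_right
      (mul_le_mul_of_nonneg_right hR (h.nonneg x)) (pow_nonneg h.rate_nonneg k))

theorem integral_densityMeasure {p : ℝ≥0 → ℝ≥0} (hp : Measurable p) (ψ : ℝ≥0 → ℝ) :
    ∫ z, ψ z ∂(densityMeasure p) = ∫ z, ψ z * p z ∂halfLine := by
  rw [densityMeasure, integral_withDensity_eq_integral_smul hp]
  simp_rw [NNReal.smul_def, smul_eq_mul, mul_comm]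

theorem integrable_densityMeasure_iff {p : ℝ≥0 → ℝ≥0} (hp : Measurable p) {ψ : ℝ≥0 → ℝ} :
    Integrable ψ (densityMeasure p) ↔ Integrable (fun z => ψ z * p z) halfLine := by
  rw [densityMeasure, integrable_withDensity_iff_integrable_smul hp]
  simp_rw [NNReal.smul_def, smul_eq_mul, mul_comm]

/-- `p` is the density of the unique invariant law of `K`; this law integrates `W` to at most `D`,
and the iterates of `K` converge to it at a geometric rate in the `W`-weighted norm. -/
structure IsErgodicDensity (K : Kernel ℝ≥0 ℝ≥0) (W : ℝ≥0 → ℝ) (R γ D : ℝ) (p : ℝ≥0 → ℝ≥0) :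
    Prop where
  isUniqueInvariantDensity : IsUniqueInvariantDensity K p
  integrable : Integrable W (densityMeasure p)
  integral_le : ∫ z, W z ∂(densityMeasure p) ≤ D
  isGeometricallyErgodic : IsGeometricallyErgodic K (densityMeasure p) W R γ

theorem IsHarris.exists_isErgodicDensity {K : Kernel ℝ≥0 ℝ≥0} [IsMarkovKernel K] {W : ℝ≥0 → ℝ}
    {η C ε d R γ : ℝ} {N : ℕ} (h : IsHarris K W η C ε d N) (hosc : GeometricOscillation K W R γ)
    (hR : 0 ≤ R) (hγ0 : 0 ≤ γ) (hγ : γ < 1) (hac : ∀ x, K x ≪ halfLine) :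
    ∃ p, IsErgodicDensity K W (R * (1 + C / (1 - η))) γ (C / (1 - η)) p := by
  have hWK : Integrable W (K 0) := pow_one K ▸ h.integrable_pow 1 0
  obtain ⟨p, hp, hprob, hinv⟩ := hosc.exists_invariant_density hγ h.one_le hWK hac
  have : IsProbabilityMeasure (densityMeasure p) := hprob
  obtain ⟨hWp, hWC⟩ := h.integrable_and_integral_le_of_invariant hinv
  exact ⟨p, ⟨hp, hprob, hinv, fun π _ hπ => hosc.invariant_unique hγ0 hγ h.one_le hπ hinv
    (h.integrable_and_integral_le_of_invariant hπ).1 hWp⟩, hWp, hWC,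
    h.isGeometricallyErgodic hosc hR hγ0 hγ hinv⟩

variable {φ : ℝ≥0 → ℝ≥0 → ℝ≥0} {f : ℝ≥0 ≃o ℝ≥0} {κ : ℝ} {m M : ℝ≥0 → ℝ} {r : ℝ≥0} {a b : ℝ}

theorem Assumptions.exists_uniform_isHarris (hyp : Assumptions φ f κ m M) (hr : 0 < r)
    (ha : 0 < a) (hb : 0 < b) (L : ℝ) :
    ∃ (C ε d : ℝ) (N : ℕ), 0 < C ∧ 0 < ε ∧ ε ≤ 1 ∧ 2 * (C / (1 - 1 / 2)) < (1 - 1 / 2) * d ∧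
      0 < N ∧ ∀ rate ∈ rateClass f m M r L a b,
        IsHarris (jumpKernel φ f rate) (V f a b) (1 / 2) C ε d N := by
  obtain ⟨C, hC, hdrift⟩ := hyp.exists_geometricDrift r ha hb L
  obtain ⟨ε, N, hε, hε1, hN, hmin⟩ := hyp.exists_minorization_pow hr ha hb L (8 * C + 1)
  exact ⟨C, ε, 8 * C + 1, N, hC, hε, hε1, by norm_num; linarith, hN, fun rate hrate =>
    { measurable := measurable_V f a b
      one_le := one_le_V f ha hb
      eta_nonneg := by norm_num
      eta_lt_one := by norm_num
      const_nonneg := hC.le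
      drift := hdrift rate hrate
      steps_pos := hN
      minorization := hmin rate hrate }⟩

theorem Assumptions.exists_uniform_isErgodicDensity (hyp : Assumptions φ f κ m M) (hr : 0 < r)
    (ha : 0 < a) (hb : 0 < b) (L : ℝ) :
    ∃ (R γ D : ℝ) (ν : (ℝ≥0 → ℝ≥0) → ℝ≥0 → ℝ≥0), 0 < R ∧ 0 < γ ∧ γ < 1 ∧
      ∀ rate ∈ rateClass f m M r L a b,
        IsErgodicDensity (jumpKernel φ f rate) (V f a b) R γ D (ν rate) := by
  obtain ⟨C, ε, d, N, hC, hε, hε1, hd, hN, hharris⟩ := hyp.exists_uniform_isHarris hr ha hb L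
  obtain ⟨R, γ, hR, hγ0, hγ, hosc⟩ :=
    exists_uniform_geometricOscillation (V f a b) (by norm_num) hC hε hε1 hd hN
  have hdensity : ∀ rate ∈ rateClass f m M r L a b, ∃ p, IsErgodicDensity (jumpKernel φ f rate)
      (V f a b) (R * (1 + C / (1 - 1 / 2))) γ (C / (1 - 1 / 2)) p := fun rate hrate => by
    have := hyp.isMarkovKernel_jumpKernel ha hb hrate
    exact (hharris rate hrate).exists_isErgodicDensity (hosc _ (hharris rate hrate)) hR.le hγ0.le hγ
      (hyp.jumpKernel_absolutelyContinuous hrate.1)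
  choose! ν hν using hdensity
  exact ⟨_, γ, _, ν, by positivity, hγ0, hγ, hν⟩

section ErgodicDensity

variable {K : Kernel ℝ≥0 ℝ≥0} {R γ D : ℝ} {p : ℝ≥0 → ℝ≥0}

theorem IsErgodicDensity.G_le {R' : ℝ} (h : IsErgodicDensity K (V f a b) R γ D p) (hR' : 0 ≤ R')
    (z : ℝ≥0) : G f a b R' γ p z ≤ R' / (1 - γ) * (V f a b z + D) := by
  have h1γ := sub_pos.2 h.isGeometricallyErgodic.rate_lt_one
  rw [G, ← integral_densityMeasure h.isUniqueInvariantDensity.measurable]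
  gcongr
  exact h.integral_le

theorem IsErgodicDensity.mul_integral_abs_mul_V_le {R' S : ℝ} {s : ℝ≥0 → ℝ}
    (h : IsErgodicDensity K (V f a b) R γ D p) (hR' : 0 ≤ R') (hs : Measurable s)
    (hsS : ∀ z, |s z| ≤ S) :
    R' / (1 - γ) * ∫ z, |s z| * V f a b z ∂(densityMeasure p) ≤
      ∫ z, |s z| * p z * G f a b R' γ p z ∂halfLine := by
  have hp := h.isUniqueInvariantDensity.measurable
  have := h.isUniqueInvariantDensity.isProbabilityMeasure
  have hV0 := h.isGeometricallyErgodic.nonneg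
  have h1γ := sub_pos.2 h.isGeometricallyErgodic.rate_lt_one
  set I := ∫ x, V f a b x * p x ∂halfLine with hI
  have hI0 : 0 ≤ I := integral_nonneg fun x => mul_nonneg (hV0 x) (p x).2
  have hsV : Integrable (fun z => |s z| * V f a b z) (densityMeasure p) :=
    h.integrable.bdd_mul hs.norm.aestronglyMeasurable (ae_of_all _ fun z => by simpa using hsS z)
  have hsI : Integrable (fun z => |s z| * I) (densityMeasure p) :=
    (integrable_of_bdd hs.abs fun z => by simpa using hsS z).mul_const I
  calc R' / (1 - γ) * ∫ z, |s z| * V f a b z ∂(densityMeasure p)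
      ≤ R' / (1 - γ) * ∫ z, (|s z| * V f a b z + |s z| * I) ∂(densityMeasure p) := by
        refine mul_le_mul_of_nonneg_left (integral_mono hsV (hsV.add hsI) fun z => ?_)
          (by positivity)
        exact le_add_of_nonneg_right (by positivity)
    _ = ∫ z, |s z| * p z * G f a b R' γ p z ∂halfLine := by
        rw [integral_densityMeasure hp, ← integral_const_mul]
        refine integral_congr_ae (ae_of_all _ fun z => ?_)
        simp only [G, ← hI]
        ring

theorem IsJumpChain.isMarkovChain {Ω : Type*} [MeasurableSpace Ω] {P : Measure Ω}
    {rate : ℝ≥0 → ℝ≥0} {x₀ : ℝ≥0} {Z : ℕ → Ω → ℝ≥0} (h : IsJumpChain P φ f rate x₀ Z) :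
    IsMarkovChain P (jumpKernel φ f rate) x₀ Z :=
  ⟨h.measurable, h.init, h.transition⟩

theorem IsErgodicDensity.variance_mean_le {Ω : Type*} [MeasurableSpace Ω] {P : Measure Ω}
    [IsProbabilityMeasure P] [IsMarkovKernel K] {x₀ : ℝ≥0} {Z : ℕ → Ω → ℝ≥0} {s : ℝ≥0 → ℝ}
    {S : ℝ} (h : IsErgodicDensity K (V f a b) R γ D p) (hZ : IsMarkovChain P K x₀ Z)
    (hs : Measurable s) (hsS : ∀ z, |s z| ≤ S) {n : ℕ} (hn : 1 ≤ n) :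
    Var[fun ω => (1 / n : ℝ) * ∑ k ∈ Finset.Icc 1 n, s (Z k ω); P] ≤
      1 / n * ∫ z, s z ^ 2 * p z ∂halfLine +
        S / n * ∫ z, |s z| * p z * G f a b (2 * R) γ p z ∂halfLine +
        (R * V f a b x₀ * (1 / (1 - γ)) +
          2 * (R * V f a b x₀ * (R + 1)) * ∑' k : ℕ, (k : ℝ) * γ ^ k) * S ^ 2 / n ^ 2 := by
  have hS : 0 ≤ S := (abs_nonneg _).trans (hsS x₀)
  have := h.isUniqueInvariantDensity.isProbabilityMeasure
  have hG := h.mul_integral_abs_mul_V_le (mul_nonneg zero_le_two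
    h.isGeometricallyErgodic.const_nonneg) hs hsS
  refine (hZ.variance_mean_le h.isGeometricallyErgodic hs hsS hn).trans ?_
  rw [← integral_densityMeasure h.isUniqueInvariantDensity.measurable]
  gcongr

end ErgodicDensity

end UniformErgodicity

end PDMP

theorem mainTheorem8_general (φ : ℝ≥0 → ℝ≥0 → ℝ≥0) (f : ℝ≥0 ≃o ℝ≥0) (κ : ℝ) (m M : ℝ≥0 → ℝ)
    (hyp : PDMP.Assumptions φ f κ m M)
    (r : ℝ≥0) (L a b : ℝ) (hr : 0 < r) (ha : 0 < a) (hb : 0 < b) :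
    ∃ (R γ : ℝ) (ν : (ℝ≥0 → ℝ≥0) → ℝ≥0 → ℝ≥0),
      0 < R ∧ 0 < γ ∧ γ < 1 ∧
      (∀ rate ∈ PDMP.rateClass f m M r L a b,
        PDMP.IsUniqueInvariantDensity (PDMP.jumpKernel φ f rate) (ν rate) ∧
        Integrable (fun x => PDMP.V f a b x * ν rate x) PDMP.halfLine ∧
        ∀ (k : ℕ) (x : ℝ≥0),
          Integrable (PDMP.V f a b) ((PDMP.jumpKernel φ f rate ^ k) x) ∧
          ∀ ψ : ℝ≥0 → ℝ, Measurable ψ → (∀ z, |ψ z| ≤ PDMP.V f a b z) →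
            |∫ z, ψ z ∂((PDMP.jumpKernel φ f rate ^ k) x) - ∫ z, ψ z * ν rate z ∂PDMP.halfLine|
              ≤ R * PDMP.V f a b x * γ ^ k) ∧
      (∀ z : ℝ≥0, ∃ C : ℝ, ∀ rate ∈ PDMP.rateClass f m M r L a b,
        PDMP.G f a b R γ (ν rate) z ≤ C) ∧
      ∀ x₀ : ℝ≥0, ∃ c : ℝ, ∀ rate ∈ PDMP.rateClass f m M r L a b,
        ∀ (Ω : Type*) [MeasurableSpace Ω] (P : Measure Ω) [IsProbabilityMeasure P]
          (Z : ℕ → Ω → ℝ≥0), PDMP.IsJumpChain P φ f rate x₀ Z →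
        ∀ s : ℝ≥0 → ℝ, Measurable s → BddAbove (Set.range fun x => |s x|) →
        ∀ n : ℕ, 1 ≤ n →
          |∫ ω, ((1 / n : ℝ) * ∑ k ∈ Finset.Icc 1 n, s (Z k ω)
              - ∫ x, s x * ν rate x ∂PDMP.halfLine) ∂P|
            ≤ PDMP.supNorm s * (R * PDMP.V f a b x₀ / (n * (1 - γ))) ∧
          variance (fun ω => (1 / n : ℝ) * ∑ k ∈ Finset.Icc 1 n, s (Z k ω)) P
            ≤ 1 / n * ∫ z, s z ^ 2 * ν rate z ∂PDMP.halfLine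
              + PDMP.supNorm s / n *
                ∫ z, |s z| * ν rate z * PDMP.G f a b R γ (ν rate) z ∂PDMP.halfLine
              + c * PDMP.supNorm s ^ 2 / n ^ 2 := by
  obtain ⟨R, γ, D, ν, hR, hγ0, hγ, hν⟩ := hyp.exists_uniform_isErgodicDensity hr ha hb L
  -- Doubling the constant of the contraction makes room for the covariances.
  have hRR : R ≤ 2 * R := by linarith
  refine ⟨2 * R, γ, ν, by positivity, hγ0, hγ, fun rate hrate => ?_, fun z => ?_, fun x₀ => ?_⟩
  · have hp := (hν rate hrate).isUniqueInvariantDensity.measurable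
    have herg := (hν rate hrate).isGeometricallyErgodic.mono hRR
    refine ⟨(hν rate hrate).isUniqueInvariantDensity,
      (PDMP.integrable_densityMeasure_iff hp).1 (hν rate hrate).integrable,
      fun k x => ⟨herg.integrable_pow k x, fun ψ hψ hψV => ?_⟩⟩
    rw [← PDMP.integral_densityMeasure hp]
    exact herg.abs_integral_pow_sub_le k x ψ hψ hψV
  · exact ⟨_, fun rate hrate => (hν rate hrate).G_le (hR.le.trans hRR) z⟩
  · refine ⟨_, fun rate hrate Ω _ P _ Z hZ s hs hbdd n hn =>
      have := hyp.isMarkovKernel_jumpKernel ha hb hrate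
      ⟨?_, (hν rate hrate).variance_mean_le hZ.isMarkovChain hs (le_ciSup hbdd) hn⟩⟩
    rw [← PDMP.integral_densityMeasure (hν rate hrate).isUniqueInvariantDensity.measurable]
    exact hZ.isMarkovChain.bias_le ((hν rate hrate).isGeometricallyErgodic.mono hRR) hs
      (le_ciSup hbdd) hn

theorem mainTheorem8 (φ : ℝ≥0 → ℝ≥0 → ℝ≥0) (f : ℝ≥0 ≃o ℝ≥0) (κ : ℝ) (m M : ℝ≥0 → ℝ)
    (hyp : PDMP.Assumptions φ f κ m M)
    (r : ℝ≥0) (L a b : ℝ) (hpar : PDMP.Parameters f κ r L a b) :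
    ∃ (R γ : ℝ) (ν : (ℝ≥0 → ℝ≥0) → ℝ≥0 → ℝ≥0),
      0 < R ∧ 0 < γ ∧ γ < 1 ∧
      -- `ν rate` is the invariant density, and `R`, `γ` are constants of the uniform contraction
      (∀ rate ∈ PDMP.rateClass f m M r L a b,
        PDMP.IsUniqueInvariantDensity (PDMP.jumpKernel φ f rate) (ν rate) ∧
        Integrable (fun x => PDMP.V f a b x * ν rate x) PDMP.halfLine ∧
        ∀ (k : ℕ) (x : ℝ≥0),
          Integrable (PDMP.V f a b) ((PDMP.jumpKernel φ f rate ^ k) x) ∧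
          ∀ ψ : ℝ≥0 → ℝ, Measurable ψ → (∀ z, |ψ z| ≤ PDMP.V f a b z) →
            |∫ z, ψ z ∂((PDMP.jumpKernel φ f rate ^ k) x) - ∫ z, ψ z * ν rate z ∂PDMP.halfLine|
              ≤ R * PDMP.V f a b x * γ ^ k) ∧
      -- `G` is bounded uniformly over the class
      (∀ z : ℝ≥0, ∃ C : ℝ, ∀ rate ∈ PDMP.rateClass f m M r L a b,
        PDMP.G f a b R γ (ν rate) z ≤ C) ∧
      -- the bias and variance bounds
      ∀ x₀ : ℝ≥0, ∃ c : ℝ, ∀ rate ∈ PDMP.rateClass f m M r L a b,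
        ∀ (Ω : Type*) [MeasurableSpace Ω] (P : Measure Ω) [IsProbabilityMeasure P]
          (Z : ℕ → Ω → ℝ≥0), PDMP.IsJumpChain P φ f rate x₀ Z →
        ∀ s : ℝ≥0 → ℝ, Measurable s → BddAbove (Set.range fun x => |s x|) →
        ∀ n : ℕ, 1 ≤ n →
          |∫ ω, ((1 / n : ℝ) * ∑ k ∈ Finset.Icc 1 n, s (Z k ω)
              - ∫ x, s x * ν rate x ∂PDMP.halfLine) ∂P|
            ≤ PDMP.supNorm s * (R * PDMP.V f a b x₀ / (n * (1 - γ))) ∧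
          variance (fun ω => (1 / n : ℝ) * ∑ k ∈ Finset.Icc 1 n, s (Z k ω)) P
            ≤ 1 / n * ∫ z, s z ^ 2 * ν rate z ∂PDMP.halfLine
              + PDMP.supNorm s / n *
                ∫ z, |s z| * ν rate z * PDMP.G f a b R γ (ν rate) z ∂PDMP.halfLine
              + c * PDMP.supNorm s ^ 2 / n ^ 2 :=
  mainTheorem8_general φ f κ m M hyp r L a b hpar.r_pos hpar.a_pos hpar.b_pos
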